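/- Let $\gamma\in(0,1)$, $T>0$, and let $E_{\gamma,1}(z)=\sum_{n\ge 0} z^n/\Gamma(\gamma n+1)$ be the Mittag-Leffler function. Let $\mathbf K:L^2(\mathbb R)\to L^2(\mathbb R)$, $\mathbf K\theta_0=\theta_T$, be the operator that maps the initial value to the final value of the fractional heat equation $\partial_t^\gamma w=\Delta w$ on $\mathbb R\times(0,T)$ (Caputo derivative), that is, $\mathcal F(\mathbf K\theta_0)(\omega)=E_{\gamma,1}(-|\omega|^2T^\gamma)\,\mathcal F\theta_0(\omega)$, where $\mathcal F f(\omega)=\int_{\mathbb R} f(t)e^{-i\omega t}\,dt$. Let $\psi$ be a mother wavelet, i.e. the functions $u_\lambda(x)=2^{\lambda_D/2}\psi(2^{\lambda_D}x-\lambda_T)$, $\lambda=(\lambda_D,\lambda_T)\in\Lambda=\mathbb Z^2$, form an orthonormal basis of $L^2(\mathbb R)$, and assume that $\operatorname{supp}\mathcal F\psi\subset\{a_u\le|\omega|\le b_u\}$ for some $a_u,b_u>0$. Put $\kappa_\lambda=2^{-2\lambda_D}$ for $\lambda_D\ge1$, $\kappa_\lambda=1$ for $\lambda_D<1$, and define $v_\lambda$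 by $\mathcal F v_\lambda(\omega)=\kappa_\lambda E_{\gamma,1}(-|\omega|^2T^\gamma)^{-1}\mathcal F u_\lambda(\omega)$. For $p,E>0$ let $$\mathbf M_{p,E}=\Big\{\theta\in L^2(\mathbb R):\ \sum_{\lambda\in\Lambda}\kappa_\lambda^{-p}|\langle\theta,u_\lambda\rangle|^2\le E^2\Big\},$$ and for $\alpha>0$ and data $y\in L^2(\mathbb R)$ let $$R_\alpha y=\sum_{\lambda\in\Lambda}\frac{\kappa_\lambda}{\alpha+\kappa_\lambda^2}\langle y,v_\lambda\rangle u_\lambda$$ be the Tikhonov-regularized solution. For a set $\mathbf M\subset L^2(\mathbb R)$ and a map $R:L^2(\mathbb R)\to L^2(\mathbb R)$ put $\Delta(\mathbf M,\delta,R)=\sup\{\|Ry-\theta\|:\theta\in\mathbf M,\ y\in L^2(\mathbb R),\ \|\mathbf K\theta-y\|\le\delta\}$. A family of maps $(R^\delta)_{\delta>0}$ is called uniformly order optimal on $\mathbf M$ if there are $c,\delta_0>0$ with $\Delta(\mathbf M,\delta,R^\delta)\le c\,\inf_R\Delta(\mathbf M,\delta,R)$ for all $\delta\in(0,\delta_0)$,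 the infimum being over all maps $R:L^2(\mathbb R)\to L^2(\mathbb R)$. Then the series that defines $R_\alpha y$ converges unconditionally in $L^2(\mathbb R)$ for all $\alpha>0$ and $y\in L^2(\mathbb R)$, and the following holds. (a) Let $0<p\le4$ and $\alpha(\delta)=(\delta/E)^{4/(p+2)}$. There is a constant $C>0$, independent of $E$, $\delta$, $\theta_0$ and $y^\delta$, such that for all $E,\delta>0$, all $\theta_0\in\mathbf M_{p,E}$ and all $y^\delta$ with $\|\mathbf K\theta_0-y^\delta\|\le\delta$, $$\|R_{\alpha(\delta)}y^\delta-\theta_0\|\le C\,\delta^{\frac p{p+2}}E^{\frac2{p+2}},$$ and for every $E>0$ the method $y\mapsto R_{\alpha(\delta)}y$ is uniformly order optimal on $\mathbf M_{p,E}$. (b) Let $0<p\le2$, $\tau>1$, and let $B_v>0$ be an upper frame bound of $(v_\lambda)$, i.e. $\sum_\lambda|\langle z,v_\lambda\rangle|^2\le B_v\|z\|^2$ for all $z\in\overline{\operatorname{ran}\mathbf K}$. There is a constant $C>0$, independent of $E$, $\delta$, $\theta_0$, $y^\delta$ and $\alpha_D$, such that for all $E,\delta>0$, all $\theta_0\in\mathbf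 M_{p,E}$, all $y^\delta$ with $\|\mathbf K\theta_0-y^\delta\|\le\delta$, and every $\alpha_D>0$ that satisfies the Morozov discrepancy equation $$\Big(\sum_{\lambda\in\Lambda}|\langle \mathbf K R_{\alpha_D}y^\delta-y^\delta,v_\lambda\rangle|^2\Big)^{1/2}=\tau\sqrt{B_v}\,\delta ,$$ one has $$\|R_{\alpha_D}y^\delta-\theta_0\|\le C\,\delta^{\frac p{p+2}}E^{\frac2{p+2}}.$$ Moreover, for every $E>0$, the method that maps $y$ to $R_{\alpha_D(\delta,y)}y$ with a solution $\alpha_D(\delta,y)$ of the discrepancy equation if one exists, and to $0$ (the limit of $R_\alpha y$ as $\alpha\to\infty$) otherwise, is uniformly order optimal on $\mathbf M_{p,E}$. -/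

import Mathlib

open MeasureTheory FourierTransform
open scoped ENNReal

noncomputable section

namespace FracBackward

/-! ### Frames, source sets, filter regularization and order optimality in Hilbert spaces -/

section General

variable {ι X Y : Type*}
  [NormedAddCommGroup X] [InnerProductSpace ℂ X] [NormedAddCommGroup Y] [InnerProductSpace ℂ Y]

/-- `B` is an upper frame bound of the family `w` on the set `S`:
`∑ l, |⟨z, w l⟩|² ≤ B ‖z‖²` for all `z ∈ S` (the series being convergent). -/
def IsUpperFrameBound (w : ι → X) (S : Set X) (B : ℝ) : Prop :=
  0 < B ∧ ∀ z ∈ S, Summable (fun l => ‖inner ℂ (w l) z‖ ^ 2) ∧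
    ∑' l, ‖inner ℂ (w l) z‖ ^ 2 ≤ B * ‖z‖ ^ 2

/-- The source set `M_{φ,E} = {x : ∑ l, φ(κ_l²)⁻¹ |⟨x, u_l⟩|² ≤ E²}`. -/
def sourceSet (φ : ℝ → ℝ) (κ : ι → ℝ) (u : ι → X) (E : ℝ) : Set X :=
  {x | Summable (fun l => (φ (κ l ^ 2))⁻¹ * ‖inner ℂ (u l) x‖ ^ 2) ∧
    ∑' l, (φ (κ l ^ 2))⁻¹ * ‖inner ℂ (u l) x‖ ^ 2 ≤ E ^ 2}

/-- The `l`-th term `κ_l g(κ_l²) ⟨y, v_l⟩ u_l` of the filtered reconstruction.  (Mathlib's inner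
product is linear in its second argument, so `⟨y, v⟩` of the mathematics is `inner ℂ v y`.) -/
def filterTerm (g : ℝ → ℝ) (κ : ι → ℝ) (u : ι → X) (v : ι → Y) (y : Y) (l : ι) : X :=
  (((κ l * g (κ l ^ 2) : ℝ) : ℂ) * inner ℂ (v l) y) • u l

/-- The filtered reconstruction `∑ l, κ_l g(κ_l²) ⟨y, v_l⟩ u_l` for an orthonormal basis `u`
(which is its own dual frame). -/
def filterReconstruction (g : ℝ → ℝ) (κ : ι → ℝ) (u : ι → X) (v : ι → Y) (y : Y) : X :=
  ∑' l, filterTerm g κ u v y l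

/-- The Tikhonov filter `g_α(μ) = 1 / (α + μ)`. -/
def tikhonovFilter (α μ : ℝ) : ℝ := 1 / (α + μ)

/-- The Tikhonov-regularized solution
`x_α = ∑ l, κ_l / (α + κ_l²) ⟨y, v_l⟩ u_l` for the data `y`. -/
def tikhonov (κ : ι → ℝ) (u : ι → X) (v : ι → Y) (α : ℝ) (y : Y) : X :=
  filterReconstruction (tikhonovFilter α) κ u v y

/-- The discrepancy `d(α) = (∑ l, |⟨K x_α - y, v_l⟩|²)^{1/2}`. -/
def discrepancy (K : X → Y) (κ : ι → ℝ) (u : ι → X) (v : ι → Y) (α : ℝ) (y : Y) : ℝ :=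
  Real.sqrt (∑' l, ‖inner ℂ (v l) (K (tikhonov κ u v α y) - y)‖ ^ 2)

/-- `α` is chosen by the Morozov principle for noise level `δ` and data `y`:
`α > 0` and `d(α) = τ √B δ`. -/
def IsMorozov (K : X → Y) (κ : ι → ℝ) (u : ι → X) (v : ι → Y) (τ B δ : ℝ) (y : Y) (α : ℝ) :
    Prop :=
  0 < α ∧ discrepancy K κ u v α y = τ * Real.sqrt B * δ

/-- `αD` is a Morozov parameter choice rule: `αD δ y` solves the discrepancy equation
whenever this equation is solvable. -/
def IsMorozovRule (K : X → Y) (κ : ι → ℝ) (u : ι → X) (v : ι → Y) (τ B : ℝ)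
    (αD : ℝ → Y → ℝ) : Prop :=
  ∀ δ : ℝ, 0 < δ → ∀ y : Y,
    (∃ α, IsMorozov K κ u v τ B δ y α) → IsMorozov K κ u v τ B δ y (αD δ y)

open scoped Classical in
/-- The Tikhonov method with a Morozov rule `αD`.  For data for which the discrepancy equation has
no solution the reconstruction is `0`, the limit of `x_α` as `α → ∞`. -/
def morozovMethod (K : X → Y) (κ : ι → ℝ) (u : ι → X) (v : ι → Y) (τ B : ℝ)
    (αD : ℝ → Y → ℝ) (δ : ℝ) (y : Y) : X :=
  if ∃ α, IsMorozov K κ u v τ B δ y α then tikhonov κ u v (αD δ y) y else 0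

/-- The worst-case error
`Δ(M, δ, R) = sup {‖R y - x‖ : x ∈ M, y ∈ Y, ‖K x - y‖ ≤ δ} ∈ [0, ∞]`. -/
def worstCaseError (K : X → Y) (M : Set X) (δ : ℝ) (R : Y → X) : ℝ≥0∞ :=
  ⨆ x ∈ M, ⨆ y : Y, ⨆ _ : ‖K x - y‖ ≤ δ, ENNReal.ofReal ‖R y - x‖

/-- Uniform order optimality on `M` of a method which for noise level `δ` uses the (possibly
nonlinear) map `R δ : Y → X`: there are `c, δ₀ > 0` with
`Δ(M, δ, R δ) ≤ c inf_{R'} Δ(M, δ, R')` for all `δ ∈ (0, δ₀)`, where `R'` runs through all maps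
from `Y` to `X`. -/
def UniformOrderOptimal (K : X → Y) (M : Set X) (R : ℝ → Y → X) : Prop :=
  ∃ c : ℝ, 0 < c ∧ ∃ δ₀ : ℝ, 0 < δ₀ ∧ ∀ δ : ℝ, 0 < δ → δ < δ₀ →
    worstCaseError K M δ (R δ) ≤ ENNReal.ofReal c * ⨅ R' : Y → X, worstCaseError K M δ R'

end General

/-! ### The fractional backward problem on the real line -/

/-- The complex Hilbert space `L²(ℝ)`. -/
abbrev L2 : Type := Lp ℂ 2 (volume : Measure ℝ)

/-- The Mittag-Leffler function `E_{a,b}(z) = ∑ n, zⁿ / Γ(a n + b)` (for real `z`). -/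
def mittagLeffler (a b z : ℝ) : ℝ := ∑' n : ℕ, z ^ n / Real.Gamma (a * n + b)

open scoped Classical in
/-- Multiplication by `m` as an operator in `L²(ℝ)` on its maximal domain
`{f : m f ∈ L²(ℝ)}` (with value `0` outside the domain). -/
def mulL2 (m : ℝ → ℝ) (f : L2) : L2 :=
  if h : MemLp (fun ξ => (m ξ : ℂ) * f ξ) 2 (volume : Measure ℝ) then h.toLp _ else 0

/-- The operator `𝓕⁻¹ m 𝓕` in `L²(ℝ)`.  Mathlib's unitary Fourier transform uses the kernel
`exp (-2πi x ξ)`, so the angular frequency is `ω = 2πξ`; the multiplier `m` is given as a function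
of `ω`. -/
def fourierMultiplier (m : ℝ → ℝ) (f : L2) : L2 :=
  𝓕⁻ (mulL2 (fun ξ => m (2 * Real.pi * ξ)) (𝓕 f))

/-- The Fourier symbol `ω ↦ E_{γ,1}(-|ω|² t^γ)` of the solution operator of the fractional heat
equation `∂_t^γ w = Δ w` (Caputo derivative) at time `t`. -/
def heatSymbol (γ t ω : ℝ) : ℝ := mittagLeffler γ 1 (-(|ω| ^ 2 * t ^ γ))

/-- The forward operator `K : θ₀ ↦ θ_T` of the fractional heat equation, which maps the initial
value to the final value:  `𝓕(K θ₀)(ω) = E_{γ,1}(-|ω|² T^γ) 𝓕θ₀(ω)`. -/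
def forwardOp (γ T : ℝ) : L2 → L2 := fourierMultiplier (heatSymbol γ T)

/-- `u` is the orthonormal wavelet basis of `L²(ℝ)` generated by the mother wavelet `ψ`:
`u_{(j,k)}(x) = 2^{j/2} ψ(2^j x - k)`. -/
def IsWaveletBasis (ψ : L2) (u : HilbertBasis (ℤ × ℤ) ℂ L2) : Prop :=
  ∀ l : ℤ × ℤ, (u l : ℝ → ℂ) =ᵐ[volume]
    fun x => (((2 : ℝ) ^ ((l.1 : ℝ) / 2) : ℝ) : ℂ) * ψ ((2 : ℝ) ^ l.1 * x - (l.2 : ℝ))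

/-- `supp 𝓕ψ ⊆ {ω : a ≤ |ω| ≤ b}`, where `ω = 2πξ`. -/
def FourierSupportedIn (ψ : L2) (a b : ℝ) : Prop :=
  ∀ᵐ ξ : ℝ, (𝓕 ψ : L2) ξ ≠ 0 → a ≤ |2 * Real.pi * ξ| ∧ |2 * Real.pi * ξ| ≤ b

/-- The quasi-singular values: `κ_{(j,k)} = 2^{-2j}` for `j ≥ 1` and `κ_{(j,k)} = 1` for `j < 1`. -/
def kappa (l : ℤ × ℤ) : ℝ := if 1 ≤ l.1 then (2 : ℝ) ^ (-2 * l.1) else 1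

/-- The vaguelettes: `𝓕 v_l(ω) = κ_l E_{γ,1}(-|ω|² T^γ)⁻¹ 𝓕 u_l(ω)`. -/
def vaguelette (γ T : ℝ) (u : ℤ × ℤ → L2) (l : ℤ × ℤ) : L2 :=
  fourierMultiplier (fun ω => kappa l * (heatSymbol γ T ω)⁻¹) (u l)

/-- The source set `M_{p,E}`, that is `M_{φ,E}` with `φ(μ) = μ^{p/2}`. -/
def waveletSourceSet (u : ℤ × ℤ → L2) (p E : ℝ) : Set L2 :=
  sourceSet (fun μ => μ ^ (p / 2)) kappa u E

/-- The Tikhonov-regularized initial value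
`∑ l, κ_l / (α + κ_l²) ⟨y, v_l⟩ u_l` for the final data `y`. -/
def regSolution (γ T : ℝ) (u : ℤ × ℤ → L2) (α : ℝ) (y : L2) : L2 :=
  tikhonov kappa u (vaguelette γ T u) α y

end FracBackward

end

open FracBackward

/-!
Write `m(ω) = E_{γ,1}(-|ω|² T^γ)` for the symbol of the forward operator `K`. Everything rests on
the two-sided decay `m(ω) ≍ (1 + |ω|²)⁻¹` (`exists_heatSymbol_bounds`). It is derived from the
power series alone. Integrating termwise gives two equations for `σ ↦ E_{γ,1}(-z σ^γ)` at `σ = 1`: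
the Caputo equation, in a form containing only increments against a positive kernel
(`integral_caputo_mittagLeffler`), and the Volterra equation (`integral_volterra_mittagLeffler`).
The Caputo form admits a maximum principle, which yields positivity and monotonicity of `z ↦
E_{γ,1}(-z)`; with monotonicity, the two equations yield `(1 + Γ(1-γ) z)⁻¹ ≤ E_{γ,1}(-z) ≤ (1 + z
/ Γ(1+γ))⁻¹`.

The Fourier transform of a wavelet of scale `j` lives in the annulus `2^j a ≤ |ω| ≤ 2^j b`
(`fourierSupportedIn_wavelet`), where `κ / m` is bounded uniformly in `j`. Hence the vaguelettes
are well defined, satisfy `K* v = κ u` (`inner_vaguelette_forwardOp`) and have an upper frame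
bound on all of `L²` (`exists_isUpperFrameBound_vaguelette`), while `‖K u‖ ≲ κ` for the fine
scales. Since `m > 0`, the range of `K` is dense, so that the frame bound given in the discrepancy
principle is one on `L²`.

The rest is Hilbert space theory. The Tikhonov error has the coefficients `κ / (α + κ²) ⟨y - K θ,
v⟩ - r ⟨θ, u⟩` with `r = α / (α + κ²)`, which gives the a priori rate. The discrepancy of the data
is the `ℓ²` norm of `r ⟨y, v⟩` and differs from that of `r κ ⟨θ, u⟩` by at most `√B δ`; so the
discrepancy equation bounds `α` from below (`le_sqrt_of_isMorozov`) and, by interpolation with the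
source condition (`sqrt_tsum_interpolation`), it bounds the approximation error from above. If it
has no solution, the data are of the size of the noise (`sqrt_tsum_le_of_not_exists_isMorozov`),
and interpolation shows that the reconstruction `0` attains the rate. Order optimality holds
because the elements `± E κ^(p/2) u` of the source set with `κ^((p+2)/2) ≈ δ / E` are
indistinguishable at noise level `δ` (`uniformOrderOptimal_of_rate`).
-/

open Set Filter Topology

/-! ### The Mittag-Leffler function on the negative half-line -/

/-- Chebyshev-type lower bound: integrate `t ^ s * exp (-t)` over `[R, R + 1]` only. -/
lemma rpow_mul_exp_le_Gamma {R s : ℝ} (hR : 0 ≤ R) (hs : 0 ≤ s) :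
    R ^ s * Real.exp (-(R + 1)) ≤ Real.Gamma (s + 1) := by
  rw [Real.Gamma_eq_integral (by linarith)]
  have hint := Real.GammaIntegral_convergent (s := s + 1) (by linarith)
  have hsub : Ioc R (R + 1) ⊆ Ioi (0 : ℝ) := fun x hx => lt_of_le_of_lt hR hx.1
  calc R ^ s * Real.exp (-(R + 1))
      = ∫ _ in Ioc R (R + 1), R ^ s * Real.exp (-(R + 1)) := by simp
    _ ≤ ∫ x in Ioc R (R + 1), Real.exp (-x) * x ^ (s + 1 - 1) := by
        refine setIntegral_mono_on (integrableOn_const (by simp)) (hint.mono_set hsub)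
          measurableSet_Ioc ?_
        intro x hx
        rw [add_sub_cancel_right, mul_comm]
        exact mul_le_mul (Real.exp_le_exp.2 (by linarith [hx.2]))
          (Real.rpow_le_rpow hR hx.1.le hs) (by positivity) (by positivity)
    _ ≤ _ := setIntegral_mono_set hint
        ((ae_restrict_mem measurableSet_Ioi).mono fun x hx =>
          mul_nonneg (Real.exp_pos _).le (Real.rpow_nonneg (le_of_lt hx) _))
        hsub.eventuallyLE

lemma Gamma_mul_nat_add_one_pos {γ : ℝ} (hγ : 0 < γ) (n : ℕ) :
    0 < Real.Gamma (γ * n + 1) := Real.Gamma_pos_of_pos (by positivity)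

lemma summable_pow_div_Gamma {γ : ℝ} (hγ : 0 < γ) {x : ℝ} (hx : 0 ≤ x) :
    Summable fun n : ℕ => x ^ n / Real.Gamma (γ * n + 1) := by
  -- `R` is chosen such that `R ^ γ` exceeds `2 x`, which makes the series geometric
  set R : ℝ := (2 * x + 1) ^ γ⁻¹ with hRdef
  have hR : 0 < R := by positivity
  have hpow : ∀ n : ℕ, R ^ (γ * n) = (2 * x + 1) ^ n := fun n => by
    rw [hRdef, ← Real.rpow_mul (by positivity), ← mul_assoc, inv_mul_cancel₀ hγ.ne', one_mul,
      Real.rpow_natCast]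
  refine Summable.of_nonneg_of_le
    (f := fun n : ℕ => Real.exp (R + 1) * (x / (2 * x + 1)) ^ n)
    (fun n => div_nonneg (by positivity) (Gamma_mul_nat_add_one_pos hγ n).le) (fun n => ?_)
    ((summable_geometric_of_lt_one (by positivity) ?_).mul_left _)
  · rw [div_le_iff₀ (Gamma_mul_nat_add_one_pos hγ n)]
    have h := rpow_mul_exp_le_Gamma hR.le (s := γ * n) (by positivity)
    rw [hpow] at h
    calc x ^ n = Real.exp (R + 1) * (x / (2 * x + 1)) ^ n
          * ((2 * x + 1) ^ n * Real.exp (-(R + 1))) := by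
          rw [Real.exp_neg, div_pow]; field_simp
      _ ≤ _ := by gcongr
  · rw [div_lt_one (by positivity)]; linarith

lemma hasSum_mittagLeffler {γ : ℝ} (hγ : 0 < γ) (x : ℝ) :
    HasSum (fun n : ℕ => x ^ n / Real.Gamma (γ * n + 1)) (mittagLeffler γ 1 x) := by
  refine Summable.hasSum (Summable.of_norm ?_)
  convert summable_pow_div_Gamma hγ (abs_nonneg x) using 2 with n
  rw [norm_div, norm_pow, Real.norm_eq_abs, Real.norm_of_nonneg (Gamma_mul_nat_add_one_pos hγ n).le]

lemma continuous_mittagLeffler {γ : ℝ} (hγ : 0 < γ) : Continuous (mittagLeffler γ 1) := by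
  rw [continuous_iff_continuousAt]
  intro x
  have h : ContinuousOn (mittagLeffler γ 1) (Icc (-(|x| + 1)) (|x| + 1)) := by
    refine continuousOn_tsum (fun n => by fun_prop)
      (summable_pow_div_Gamma hγ (x := |x| + 1) (by positivity)) fun n y hy => ?_
    rw [norm_div, norm_pow, Real.norm_eq_abs,
      Real.norm_of_nonneg (Gamma_mul_nat_add_one_pos hγ n).le]
    have := Gamma_mul_nat_add_one_pos hγ n
    gcongr
    exact abs_le.2 hy
  refine h.continuousAt (Icc_mem_nhds ?_ ?_)
  · linarith [neg_abs_le x]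
  · linarith [le_abs_self x]

lemma mittagLeffler_zero (γ : ℝ) : mittagLeffler γ 1 0 = 1 := by
  rw [mittagLeffler, tsum_eq_single 0]
  · simp
  · intro n hn; simp [hn]

lemma integral_Ioo_beta {α β : ℝ} (hα : 0 < α) (hβ : 0 < β) :
    IntegrableOn (fun x : ℝ => x ^ (α - 1) * (1 - x) ^ (β - 1)) (Ioo 0 1) ∧
    ∫ x in Ioo (0 : ℝ) 1, x ^ (α - 1) * (1 - x) ^ (β - 1)
      = Real.Gamma α * Real.Gamma β / Real.Gamma (α + β) := by
  have hc := Complex.betaIntegral_convergent (u := α) (v := β) (by simpa) (by simpa)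
  rw [intervalIntegrable_iff_integrableOn_Ioo_of_le zero_le_one] at hc
  have heq : EqOn (fun x : ℝ => (x : ℂ) ^ ((α : ℂ) - 1) * (1 - (x : ℂ)) ^ ((β : ℂ) - 1))
      (fun x : ℝ => ((x ^ (α - 1) * (1 - x) ^ (β - 1) : ℝ) : ℂ)) (Ioo 0 1) := by
    intro x hx
    simp only [Complex.ofReal_mul]
    rw [Complex.ofReal_cpow hx.1.le, Complex.ofReal_cpow (by linarith [hx.2])]
    simp
  have hi := (hc.congr_fun heq measurableSet_Ioo)
  constructor
  · simpa only [IntegrableOn, RCLike.re_to_complex, Complex.ofReal_re] using hi.re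
  · have h1 := ProbabilityTheory.beta_eq_betaIntegralReal α β hα hβ
    rw [ProbabilityTheory.beta, Complex.betaIntegral, intervalIntegral.integral_of_le zero_le_one,
      integral_Ioc_eq_integral_Ioo, setIntegral_congr_fun measurableSet_Ioo heq,
      integral_complex_ofReal, Complex.ofReal_re] at h1
    exact h1.symm

lemma integrable_of_hasSum {α : Type*} [MeasurableSpace α] {μ : Measure α} {F : ℕ → α → ℝ}
    {g : α → ℝ} (hF_int : ∀ i, Integrable (F i) μ) (hF_sum : Summable fun i => ∫ a, ‖F i a‖ ∂μ)
    (hg : AEStronglyMeasurable g μ) (h : ∀ᵐ a ∂μ, HasSum (fun i => F i a) (g a)) :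
    Integrable g μ := by
  refine ⟨hg, ?_⟩
  calc ∫⁻ a, ‖g a‖ₑ ∂μ ≤ ∫⁻ a, ∑' i, ‖F i a‖ₑ ∂μ := by
        refine lintegral_mono_ae (h.mono fun a ha => ?_)
        rw [← ha.tsum_eq]
        exact enorm_tsum_le_tsum_enorm
    _ = ∑' i, ∫⁻ a, ‖F i a‖ₑ ∂μ := lintegral_tsum fun i => (hF_int i).1.enorm
    _ = ∑' i, ENNReal.ofReal (∫ a, ‖F i a‖ ∂μ) := by
        congr 1 with i
        rw [ofReal_integral_norm_eq_lintegral_enorm (hF_int i)]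
    _ < ⊤ := hF_sum.tsum_ofReal_lt_top

/-- The power functions `σ ^ β` are Lipschitz at the right endpoint of `[0, 1]`. -/
lemma one_sub_rpow_le {β σ : ℝ} (hβ : 0 ≤ β) (h0 : 0 ≤ σ) (h1 : σ ≤ 1) :
    1 - σ ^ β ≤ max 1 β * (1 - σ) := by
  rcases le_total 1 β with h | h
  · have := one_add_mul_self_le_rpow_one_add (s := σ - 1) (by linarith) h
    rw [max_eq_right h]
    rw [add_sub_cancel] at this
    linarith
  · rw [max_eq_left h]
    have : σ ^ (1 : ℝ) ≤ σ ^ β := Real.rpow_le_rpow_of_exponent_ge' h0 h1 hβ h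
    rw [Real.rpow_one] at this
    linarith

/-- The Caputo derivative of a power function, in the form obtained by an integration by parts. -/
lemma integral_caputo_rpow {γ β : ℝ} (hγ0 : 0 < γ) (hγ1 : γ < 1) (hβ : 0 < β) :
    IntegrableOn (fun σ : ℝ => (1 - σ) ^ (-γ - 1) * (1 - σ ^ β)) (Ioo 0 1) ∧
    ∫ σ in Ioo (0 : ℝ) 1, (1 - σ) ^ (-γ - 1) * (1 - σ ^ β)
      = (Real.Gamma (1 - γ) * Real.Gamma (β + 1) / Real.Gamma (β + 1 - γ) - 1) / γ := by
  obtain ⟨hB, hBv⟩ := integral_Ioo_beta hβ (sub_pos.2 hγ1)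
  have hpw := (integral_Ioo_beta one_pos (sub_pos.2 hγ1)).1
  have hint : IntegrableOn (fun σ : ℝ => (1 - σ) ^ (-γ - 1) * (1 - σ ^ β)) (Ioo 0 1) := by
    refine Integrable.mono' (hpw.const_mul (max 1 β)) ?_ ?_
    · refine ContinuousOn.aestronglyMeasurable ?_ measurableSet_Ioo
      refine ContinuousOn.mul ?_ ?_
      · exact ContinuousOn.rpow_const (by fun_prop) fun x hx => Or.inl (by linarith [hx.2])
      · exact continuousOn_const.sub
          (ContinuousOn.rpow_const continuousOn_id fun x hx => Or.inl hx.1.ne')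
    · refine (ae_restrict_mem measurableSet_Ioo).mono fun σ hσ => ?_
      have h1 : 0 < 1 - σ := by linarith [hσ.2]
      have h2 : σ ^ β ≤ 1 := Real.rpow_le_one hσ.1.le hσ.2.le hβ.le
      rw [Real.norm_of_nonneg (mul_nonneg (by positivity) (by linarith))]
      calc (1 - σ) ^ (-γ - 1) * (1 - σ ^ β)
          ≤ (1 - σ) ^ (-γ - 1) * (max 1 β * (1 - σ)) := by
            gcongr; exact one_sub_rpow_le hβ.le hσ.1.le hσ.2.le
        _ = max 1 β * (σ ^ ((1 : ℝ) - 1) * (1 - σ) ^ (1 - γ - 1)) := by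
            have : (1 - σ) ^ (1 - γ - 1) = (1 - σ) ^ (-γ - 1) * (1 - σ) := by
              rw [← Real.rpow_add_one h1.ne']; ring_nf
            rw [this]; simp; ring
  refine ⟨hint, ?_⟩
  -- the antiderivative `(1 - σ) ^ (-γ) * (1 - σ ^ β)` takes the values `1` at `0` and `0` at `1`
  have hderiv : ∀ σ ∈ Ioo (0 : ℝ) 1, HasDerivAt (fun σ : ℝ => (1 - σ) ^ (-γ) * (1 - σ ^ β))
      (γ * ((1 - σ) ^ (-γ - 1) * (1 - σ ^ β))
        - β * (σ ^ (β - 1) * (1 - σ) ^ (1 - γ - 1))) σ := by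
    intro σ hσ
    have h1 : 0 < 1 - σ := by linarith [hσ.2]
    have d1 : HasDerivAt (fun σ : ℝ => (1 - σ) ^ (-γ)) ((-1) * (-γ) * (1 - σ) ^ (-γ - 1)) σ :=
      ((hasDerivAt_id σ).const_sub 1).rpow_const (Or.inl h1.ne')
    have d2 : HasDerivAt (fun σ : ℝ => 1 - σ ^ β) (-(β * σ ^ (β - 1))) σ :=
      (Real.hasDerivAt_rpow_const (Or.inl hσ.1.ne')).const_sub 1
    refine (d1.mul d2).congr_deriv ?_
    rw [show 1 - γ - 1 = -γ by ring]; ring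
  have hcont : ContinuousOn (fun σ : ℝ => (1 - σ) ^ (-γ) * (1 - σ ^ β)) (Icc 0 1) := by
    intro σ hσ
    rcases hσ.2.lt_or_eq with hlt | rfl
    · refine ContinuousAt.continuousWithinAt (ContinuousAt.mul ?_ ?_)
      · exact ContinuousAt.rpow_const (by fun_prop) (Or.inl (by linarith))
      · exact continuousAt_const.sub (continuousAt_id.rpow_const (Or.inr hβ.le))
    · -- near `1` the second factor is at most a multiple of `1 - σ`
      have hz : Tendsto (fun σ : ℝ => max 1 β * (1 - σ) ^ (1 - γ)) (𝓝[Icc 0 1] 1) (𝓝 0) := by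
        have : ContinuousAt (fun σ : ℝ => max 1 β * (1 - σ) ^ (1 - γ)) 1 :=
          continuousAt_const.mul (ContinuousAt.rpow_const (by fun_prop) (Or.inr (by linarith)))
        have h := this.tendsto
        simp only [sub_self, Real.zero_rpow (by linarith : 1 - γ ≠ 0), mul_zero] at h
        exact h.mono_left nhdsWithin_le_nhds
      have : (1 - 1 : ℝ) ^ (-γ) * (1 - 1 ^ β) = 0 := by simp
      rw [ContinuousWithinAt, this]
      refine squeeze_zero' ?_ ?_ hz
      · filter_upwards [self_mem_nhdsWithin] with σ hσ
        exact mul_nonneg (Real.rpow_nonneg (by linarith [hσ.2]) _)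
          (by linarith [Real.rpow_le_one hσ.1 hσ.2 hβ.le])
      · filter_upwards [self_mem_nhdsWithin] with σ hσ
        rcases hσ.2.lt_or_eq with hlt | rfl
        · have h1 : 0 < 1 - σ := by linarith
          calc (1 - σ) ^ (-γ) * (1 - σ ^ β)
              ≤ (1 - σ) ^ (-γ) * (max 1 β * (1 - σ)) := by
                gcongr; exact one_sub_rpow_le hβ.le hσ.1 hσ.2
            _ = max 1 β * (1 - σ) ^ (1 - γ) := by
                rw [show 1 - γ = -γ + 1 by ring, Real.rpow_add_one h1.ne']; ring
        · simp [Real.zero_rpow (by linarith : 1 - γ ≠ 0)]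
  have hintF : IntegrableOn (fun σ : ℝ => γ * ((1 - σ) ^ (-γ - 1) * (1 - σ ^ β))
        - β * (σ ^ (β - 1) * (1 - σ) ^ (1 - γ - 1))) (Ioo 0 1) :=
    (hint.const_mul γ).sub (hB.const_mul β)
  have hftc := intervalIntegral.integral_eq_sub_of_hasDerivAt_of_le zero_le_one hcont hderiv
    ((intervalIntegrable_iff_integrableOn_Ioo_of_le zero_le_one).2 hintF)
  rw [intervalIntegral.integral_of_le zero_le_one, integral_Ioc_eq_integral_Ioo,
    integral_sub (hint.const_mul γ) (hB.const_mul β), integral_const_mul, integral_const_mul,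
    hBv] at hftc
  simp only [sub_self, Real.one_rpow, mul_zero, sub_zero, Real.zero_rpow hβ.ne'] at hftc
  rw [Real.Gamma_add_one hβ.ne', show β + 1 - γ = β + (1 - γ) by ring, eq_div_iff hγ0.ne']
  rw [show Real.Gamma (1 - γ) * (β * Real.Gamma β) / Real.Gamma (β + (1 - γ))
    = β * (Real.Gamma β * Real.Gamma (1 - γ) / Real.Gamma (β + (1 - γ))) by ring]
  linarith

/-- The Caputo equation for `σ ↦ E_{γ,1}(-z σ ^ γ)` at `σ = 1`, in the integrated form in which
the sign of the increments `E_{γ,1}(-z) - E_{γ,1}(-z σ ^ γ)` is visible. -/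
lemma integral_caputo_mittagLeffler {γ z : ℝ} (hγ0 : 0 < γ) (hγ1 : γ < 1) (hz : 0 ≤ z) :
    IntegrableOn (fun σ : ℝ => (1 - σ) ^ (-γ - 1)
      * (mittagLeffler γ 1 (-z) - mittagLeffler γ 1 (-(z * σ ^ γ)))) (Ioo 0 1) ∧
    γ * ∫ σ in Ioo (0 : ℝ) 1, (1 - σ) ^ (-γ - 1)
      * (mittagLeffler γ 1 (-z) - mittagLeffler γ 1 (-(z * σ ^ γ)))
      = 1 - mittagLeffler γ 1 (-z) - Real.Gamma (1 - γ) * z * mittagLeffler γ 1 (-z) := by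
  set F : ℕ → ℝ → ℝ := fun n σ => (-z) ^ n / Real.Gamma (γ * n + 1)
    * ((1 - σ) ^ (-γ - 1) * (1 - σ ^ (γ * n))) with hF
  have hF0 : F 0 = fun _ => 0 := by ext σ; simp [hF]
  have hval : ∀ n : ℕ, IntegrableOn (F (n + 1)) (Ioo 0 1) ∧
      ∫ σ in Ioo (0 : ℝ) 1, (1 - σ) ^ (-γ - 1) * (1 - σ ^ (γ * (n + 1 : ℕ)))
        = (Real.Gamma (1 - γ) * Real.Gamma (γ * (n + 1 : ℕ) + 1) / Real.Gamma (γ * n + 1) - 1)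
          / γ := by
    intro n
    obtain ⟨h1, h2⟩ := integral_caputo_rpow (β := γ * (n + 1 : ℕ)) hγ0 hγ1 (by positivity)
    refine ⟨h1.const_mul _, ?_⟩
    rw [h2]
    congr 4
    push_cast; ring
  have hintF : ∀ n, Integrable (F n) (volume.restrict (Ioo 0 1)) := by
    rintro (_ | n)
    · rw [hF0]; exact integrable_zero _ _ _
    · exact (hval n).1
  have hsumF : Summable fun n => ∫ σ in Ioo (0 : ℝ) 1, ‖F n σ‖ := by
    rw [← summable_nat_add_iff 1]
    refine Summable.of_nonneg_of_le (fun n => integral_nonneg fun _ => norm_nonneg _) (fun n => ?_)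
      ((summable_pow_div_Gamma hγ0 hz).mul_left (z * Real.Gamma (1 - γ) / γ))
    have hG := Gamma_mul_nat_add_one_pos hγ0 (n + 1)
    have hG' := Gamma_mul_nat_add_one_pos hγ0 n
    have : ∫ σ in Ioo (0 : ℝ) 1, ‖F (n + 1) σ‖
        = ∫ σ in Ioo (0 : ℝ) 1, z ^ (n + 1) / Real.Gamma (γ * (n + 1 : ℕ) + 1)
          * ((1 - σ) ^ (-γ - 1) * (1 - σ ^ (γ * (n + 1 : ℕ)))) := by
      refine setIntegral_congr_fun measurableSet_Ioo fun σ hσ => ?_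
      have h1 : 0 < 1 - σ := by linarith [hσ.2]
      have h2 : σ ^ (γ * (n + 1 : ℕ)) ≤ 1 :=
        Real.rpow_le_one hσ.1.le hσ.2.le (by positivity)
      simp only [hF]
      rw [norm_mul, norm_div, norm_pow, norm_neg, Real.norm_of_nonneg hz,
        Real.norm_of_nonneg hG.le,
        Real.norm_of_nonneg (mul_nonneg (by positivity) (sub_nonneg.2 h2))]
    rw [this, integral_const_mul, (hval n).2]
    calc z ^ (n + 1) / Real.Gamma (γ * (n + 1 : ℕ) + 1) *
          ((Real.Gamma (1 - γ) * Real.Gamma (γ * (n + 1 : ℕ) + 1) / Real.Gamma (γ * n + 1) - 1) / γ)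
        ≤ z ^ (n + 1) / Real.Gamma (γ * (n + 1 : ℕ) + 1) *
            (Real.Gamma (1 - γ) * Real.Gamma (γ * (n + 1 : ℕ) + 1) / Real.Gamma (γ * n + 1)
              / γ) := by
          gcongr; linarith
      _ = z * Real.Gamma (1 - γ) / γ * (z ^ n / Real.Gamma (γ * n + 1)) := by
          field_simp
          ring
  have hpoint : ∀ σ ∈ Ioo (0 : ℝ) 1, HasSum (fun n => F n σ) ((1 - σ) ^ (-γ - 1)
      * (mittagLeffler γ 1 (-z) - mittagLeffler γ 1 (-(z * σ ^ γ)))) := by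
    intro σ hσ
    have h := ((hasSum_mittagLeffler hγ0 (-z)).sub
      (hasSum_mittagLeffler hγ0 (-(z * σ ^ γ)))).mul_left ((1 - σ) ^ (-γ - 1))
    refine h.congr_fun fun n => ?_
    simp only [hF]
    rw [Real.rpow_mul hσ.1.le, Real.rpow_natCast, ← neg_mul, mul_pow]
    ring
  have hpt := (ae_restrict_mem (μ := volume) (measurableSet_Ioo (a := (0 : ℝ)) (b := 1))).mono
    hpoint
  have hae : (fun σ : ℝ => ∑' n, F n σ) =ᵐ[volume.restrict (Ioo 0 1)] fun σ => (1 - σ) ^ (-γ - 1)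
      * (mittagLeffler γ 1 (-z) - mittagLeffler γ 1 (-(z * σ ^ γ))) :=
    hpt.mono fun σ hσ => hσ.tsum_eq
  refine ⟨integrable_of_hasSum hintF hsumF ?_ hpt, ?_⟩
  · refine ContinuousOn.aestronglyMeasurable ?_ measurableSet_Ioo
    have hc := continuous_mittagLeffler hγ0
    refine ContinuousOn.mul
      (ContinuousOn.rpow_const (by fun_prop) fun x hx => Or.inl (by linarith [hx.2])) ?_
    exact continuousOn_const.sub (hc.comp_continuousOn
      (continuousOn_const.mul (continuousOn_id.rpow_const fun x hx => Or.inr hγ0.le)).neg)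
  · have h1 := hasSum_integral_of_summable_integral_norm hintF hsumF
    rw [integral_congr_ae hae, ← hasSum_nat_add_iff' 1] at h1
    simp only [Finset.range_one, Finset.sum_singleton, hF0, integral_zero, sub_zero] at h1
    have h2 := h1.mul_left γ
    have h3 := ((hasSum_mittagLeffler hγ0 (-z)).mul_left (-(Real.Gamma (1 - γ) * z))).sub
      ((hasSum_nat_add_iff' 1).2 (hasSum_mittagLeffler hγ0 (-z)))
    refine (h2.unique (h3.congr_fun ?_)).trans ?_
    · intro n
      have hG := Gamma_mul_nat_add_one_pos hγ0 (n + 1)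
      have hG' := Gamma_mul_nat_add_one_pos hγ0 n
      simp only [hF]
      rw [integral_const_mul, (hval n).2]
      field_simp
      ring
    · simp; ring

/-- The Volterra integral equation for `σ ↦ E_{γ,1}(-z σ ^ γ)` at `σ = 1`. -/
lemma integral_volterra_mittagLeffler {γ z : ℝ} (hγ0 : 0 < γ) (hz : 0 ≤ z) :
    IntegrableOn (fun σ : ℝ => (1 - σ) ^ (γ - 1) * mittagLeffler γ 1 (-(z * σ ^ γ))) (Ioo 0 1) ∧
    z * ∫ σ in Ioo (0 : ℝ) 1, (1 - σ) ^ (γ - 1) * mittagLeffler γ 1 (-(z * σ ^ γ))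
      = Real.Gamma γ * (1 - mittagLeffler γ 1 (-z)) := by
  set F : ℕ → ℝ → ℝ := fun n σ => (-z) ^ n / Real.Gamma (γ * n + 1)
    * (σ ^ (γ * n + 1 - 1) * (1 - σ) ^ (γ - 1)) with hF
  have hval : ∀ n : ℕ, IntegrableOn (F n) (Ioo 0 1) ∧
      ∫ σ in Ioo (0 : ℝ) 1, σ ^ (γ * n + 1 - 1) * (1 - σ) ^ (γ - 1)
        = Real.Gamma (γ * n + 1) * Real.Gamma γ / Real.Gamma (γ * (n + 1 : ℕ) + 1) := by
    intro n
    obtain ⟨h1, h2⟩ := integral_Ioo_beta (α := γ * n + 1) (by positivity) hγ0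
    refine ⟨h1.const_mul _, ?_⟩
    rw [h2]
    congr 2
    push_cast; ring
  have hsumF : Summable fun n => ∫ σ in Ioo (0 : ℝ) 1, ‖F n σ‖ := by
    have hs : Summable fun n : ℕ => Real.Gamma γ *
        (z ^ n / Real.Gamma (γ * (n + 1 : ℕ) + 1)) := by
      refine Summable.mul_left _ ?_
      rcases hz.eq_or_lt with rfl | hz'
      · refine summable_of_ne_finset_zero (s := {0}) fun n hn => ?_
        rw [Finset.mem_singleton] at hn
        simp [hn]
      · refine ((summable_nat_add_iff 1).2 (summable_pow_div_Gamma hγ0 hz)).mul_left z⁻¹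
          |>.congr fun n => ?_
        rw [pow_succ, mul_div_right_comm, mul_comm, mul_assoc, mul_inv_cancel₀ hz'.ne', mul_one]
    refine hs.congr fun n => ?_
    have hG' := Gamma_mul_nat_add_one_pos hγ0 n
    have : ∫ σ in Ioo (0 : ℝ) 1, ‖F n σ‖
        = ∫ σ in Ioo (0 : ℝ) 1, z ^ n / Real.Gamma (γ * n + 1)
          * (σ ^ (γ * n + 1 - 1) * (1 - σ) ^ (γ - 1)) := by
      refine setIntegral_congr_fun measurableSet_Ioo fun σ hσ => ?_
      have h0 : 0 < σ := hσ.1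
      have h1 : 0 < 1 - σ := by linarith [hσ.2]
      simp only [hF]
      rw [norm_mul, norm_div, norm_pow, norm_neg, Real.norm_of_nonneg hz,
        Real.norm_of_nonneg hG'.le, Real.norm_of_nonneg (by positivity)]
    rw [this, integral_const_mul, (hval n).2]
    field_simp
  have hpoint : ∀ᵐ σ ∂(volume.restrict (Ioo (0 : ℝ) 1)), HasSum (fun n => F n σ)
      ((1 - σ) ^ (γ - 1) * mittagLeffler γ 1 (-(z * σ ^ γ))) := by
    filter_upwards [ae_restrict_mem measurableSet_Ioo] with σ hσ
    have h := (hasSum_mittagLeffler hγ0 (-(z * σ ^ γ))).mul_left ((1 - σ) ^ (γ - 1))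
    refine h.congr_fun fun n => ?_
    simp only [hF]
    rw [add_sub_cancel_right, Real.rpow_mul hσ.1.le, Real.rpow_natCast, ← neg_mul, mul_pow]
    ring
  refine ⟨integrable_of_hasSum (fun n => (hval n).1) hsumF ?_ hpoint, ?_⟩
  · refine ContinuousOn.aestronglyMeasurable ?_ measurableSet_Ioo
    refine ContinuousOn.mul
      (ContinuousOn.rpow_const (by fun_prop) fun x hx => Or.inl (by linarith [hx.2])) ?_
    exact (continuous_mittagLeffler hγ0).comp_continuousOn
      (continuousOn_const.mul (continuousOn_id.rpow_const fun x hx => Or.inr hγ0.le)).neg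
  · have h1 := hasSum_integral_of_summable_integral_norm (fun n => (hval n).1) hsumF
    rw [integral_congr_ae (hpoint.mono fun σ hσ => hσ.tsum_eq)] at h1
    have h2 := h1.mul_left z
    have h3 := ((hasSum_nat_add_iff' 1).2 (hasSum_mittagLeffler hγ0 (-z))).mul_left (-Real.Gamma γ)
    refine (h2.unique (h3.congr_fun ?_)).trans ?_
    · intro n
      have hG := Gamma_mul_nat_add_one_pos hγ0 (n + 1)
      have hG' := Gamma_mul_nat_add_one_pos hγ0 n
      simp only [hF]
      rw [integral_const_mul, (hval n).2]
      field_simp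
      ring
    · simp; ring

/-- Maximum principle: at a negative minimum over `[0, x₀]` the Caputo derivative would be
negative, whereas the equation makes it positive. -/
lemma mittagLeffler_neg_nonneg {γ z : ℝ} (hγ0 : 0 < γ) (hγ1 : γ < 1) (hz : 0 ≤ z) :
    0 ≤ mittagLeffler γ 1 (-z) := by
  by_contra! hneg
  have hc : Continuous fun x => mittagLeffler γ 1 (-x) :=
    (continuous_mittagLeffler hγ0).comp continuous_neg
  obtain ⟨x, hx, hmin⟩ := isCompact_Icc.exists_isMinOn (nonempty_Icc.2 hz) hc.continuousOn
  have hx0 : mittagLeffler γ 1 (-x) < 0 := (hmin (right_mem_Icc.2 hz)).trans_lt hneg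
  have hI : ∫ σ in Ioo (0 : ℝ) 1, (1 - σ) ^ (-γ - 1)
      * (mittagLeffler γ 1 (-x) - mittagLeffler γ 1 (-(x * σ ^ γ))) ≤ 0 := by
    refine setIntegral_nonpos measurableSet_Ioo fun σ hσ => ?_
    refine mul_nonpos_of_nonneg_of_nonpos (Real.rpow_nonneg (by linarith [hσ.2]) _)
      (sub_nonpos.2 (hmin ⟨mul_nonneg hx.1 (Real.rpow_nonneg hσ.1.le _), ?_⟩))
    exact (mul_le_of_le_one_right hx.1 (Real.rpow_le_one hσ.1.le hσ.2.le hγ0.le)).trans hx.2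
  have h := (integral_caputo_mittagLeffler hγ0 hγ1 hx.1).2
  have hG : 0 < Real.Gamma (1 - γ) := Real.Gamma_pos_of_pos (by linarith)
  have h1 : γ * ∫ σ in Ioo (0 : ℝ) 1, (1 - σ) ^ (-γ - 1)
      * (mittagLeffler γ 1 (-x) - mittagLeffler γ 1 (-(x * σ ^ γ))) ≤ 0 :=
    mul_nonpos_of_nonneg_of_nonpos hγ0.le hI
  have h2 : Real.Gamma (1 - γ) * x * mittagLeffler γ 1 (-x) ≤ 0 :=
    mul_nonpos_of_nonneg_of_nonpos (mul_nonneg hG.le hx.1) hx0.le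
  linarith

/-- Maximum principle for the difference of the solutions with rates `1` and `c ≥ 1`. -/
lemma mittagLeffler_neg_mul_le {γ z c : ℝ} (hγ0 : 0 < γ) (hγ1 : γ < 1) (hz : 0 ≤ z)
    (hc1 : 1 ≤ c) : mittagLeffler γ 1 (-(c * z)) ≤ mittagLeffler γ 1 (-z) := by
  by_contra! hneg
  have hc : Continuous fun x => mittagLeffler γ 1 (-x) - mittagLeffler γ 1 (-(c * x)) :=
    ((continuous_mittagLeffler hγ0).comp continuous_neg).sub
      ((continuous_mittagLeffler hγ0).comp (continuous_const.mul continuous_id).neg)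
  obtain ⟨x, hx, hmin⟩ := isCompact_Icc.exists_isMinOn (nonempty_Icc.2 hz) hc.continuousOn
  have hx0 : mittagLeffler γ 1 (-x) - mittagLeffler γ 1 (-(c * x)) < 0 :=
    (hmin (right_mem_Icc.2 hz)).trans_lt (sub_neg.2 hneg)
  obtain ⟨i1, e1⟩ := integral_caputo_mittagLeffler hγ0 hγ1 hx.1
  obtain ⟨i2, e2⟩ := integral_caputo_mittagLeffler hγ0 hγ1 (z := c * x)
    (mul_nonneg (by linarith) hx.1)
  have hI : (∫ σ in Ioo (0 : ℝ) 1, (1 - σ) ^ (-γ - 1)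
      * (mittagLeffler γ 1 (-x) - mittagLeffler γ 1 (-(x * σ ^ γ))))
      - (∫ σ in Ioo (0 : ℝ) 1, (1 - σ) ^ (-γ - 1)
      * (mittagLeffler γ 1 (-(c * x)) - mittagLeffler γ 1 (-(c * x * σ ^ γ)))) ≤ 0 := by
    rw [← integral_sub i1 i2]
    refine setIntegral_nonpos measurableSet_Ioo fun σ hσ => ?_
    have hm := hmin (a := x * σ ^ γ) ⟨mul_nonneg hx.1 (Real.rpow_nonneg hσ.1.le _),
      (mul_le_of_le_one_right hx.1 (Real.rpow_le_one hσ.1.le hσ.2.le hγ0.le)).trans hx.2⟩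
    simp only [mem_ofPred_eq] at hm
    rw [← mul_sub, mul_assoc]
    refine mul_nonpos_of_nonneg_of_nonpos (Real.rpow_nonneg (by linarith [hσ.2]) _) ?_
    linarith
  have hG : 0 < Real.Gamma (1 - γ) := Real.Gamma_pos_of_pos (by linarith)
  have h1 := mul_nonpos_of_nonneg_of_nonpos hγ0.le hI
  rw [mul_sub, e1, e2] at h1
  have hpos := mittagLeffler_neg_nonneg hγ0 hγ1 (mul_nonneg (by linarith : 0 ≤ c) hx.1)
  have h2 : 0 ≤ Real.Gamma (1 - γ) * x
      * (mittagLeffler γ 1 (-(c * x)) - mittagLeffler γ 1 (-x)) :=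
    mul_nonneg (mul_nonneg hG.le hx.1) (by linarith)
  have h3 : 0 ≤ Real.Gamma (1 - γ) * x * ((c - 1) * mittagLeffler γ 1 (-(c * x))) :=
    mul_nonneg (mul_nonneg hG.le hx.1) (mul_nonneg (by linarith) hpos)
  linarith

lemma mittagLeffler_neg_antitone {γ x y : ℝ} (hγ0 : 0 < γ) (hγ1 : γ < 1) (hx : 0 ≤ x)
    (hxy : x ≤ y) : mittagLeffler γ 1 (-y) ≤ mittagLeffler γ 1 (-x) := by
  -- at `0` the comparison of two positive rates degenerates, hence the passage to the limit
  have hpos : ∀ t : ℝ, 0 < t → t ≤ y → mittagLeffler γ 1 (-y) ≤ mittagLeffler γ 1 (-t) := by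
    intro t ht hty
    have := mittagLeffler_neg_mul_le hγ0 hγ1 ht.le ((one_le_div ht).2 hty)
    rwa [div_mul_cancel₀ _ ht.ne'] at this
  rcases hx.eq_or_lt with rfl | hx'
  · rcases hxy.eq_or_lt with rfl | hy
    · exact le_rfl
    · have hlim : Tendsto (fun t => mittagLeffler γ 1 (-t)) (𝓝[>] 0) (𝓝 (mittagLeffler γ 1 (-0))) :=
        (((continuous_mittagLeffler hγ0).comp continuous_neg).tendsto 0).mono_left
          nhdsWithin_le_nhds
      refine ge_of_tendsto hlim ?_
      filter_upwards [Ioo_mem_nhdsGT hy] with t ht using hpos t ht.1 ht.2.le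
  · exact hpos x hx' hxy

/-- Lower decay bound: by monotonicity the integral in the Caputo equation is nonpositive. -/
lemma one_le_mittagLeffler_mul {γ z : ℝ} (hγ0 : 0 < γ) (hγ1 : γ < 1) (hz : 0 ≤ z) :
    1 ≤ mittagLeffler γ 1 (-z) * (1 + Real.Gamma (1 - γ) * z) := by
  have h := (integral_caputo_mittagLeffler hγ0 hγ1 hz).2
  have hI : ∫ σ in Ioo (0 : ℝ) 1, (1 - σ) ^ (-γ - 1)
      * (mittagLeffler γ 1 (-z) - mittagLeffler γ 1 (-(z * σ ^ γ))) ≤ 0 := by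
    refine setIntegral_nonpos measurableSet_Ioo fun σ hσ => ?_
    refine mul_nonpos_of_nonneg_of_nonpos (Real.rpow_nonneg (by linarith [hσ.2]) _)
      (sub_nonpos.2 (mittagLeffler_neg_antitone hγ0 hγ1
        (mul_nonneg hz (Real.rpow_nonneg hσ.1.le _))
        (mul_le_of_le_one_right hz (Real.rpow_le_one hσ.1.le hσ.2.le hγ0.le))))
  have := mul_nonpos_of_nonneg_of_nonpos hγ0.le hI
  linarith

/-- Upper decay bound: by monotonicity the integral in the Volterra equation is at least
`E_{γ,1}(-z) / γ`. -/
lemma mittagLeffler_mul_le_one {γ z : ℝ} (hγ0 : 0 < γ) (hγ1 : γ < 1) (hz : 0 ≤ z) :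
    mittagLeffler γ 1 (-z) * (1 + z / Real.Gamma (γ + 1)) ≤ 1 := by
  obtain ⟨hi, he⟩ := integral_volterra_mittagLeffler hγ0 hz
  obtain ⟨hb, hbv⟩ := integral_Ioo_beta one_pos hγ0
  have hG : 0 < Real.Gamma γ := Real.Gamma_pos_of_pos hγ0
  simp only [sub_self, Real.rpow_zero, one_mul] at hb hbv
  rw [Real.Gamma_one, add_comm 1 γ, Real.Gamma_add_one hγ0.ne', one_mul] at hbv
  have hI : mittagLeffler γ 1 (-z) * γ⁻¹
      ≤ ∫ σ in Ioo (0 : ℝ) 1, (1 - σ) ^ (γ - 1) * mittagLeffler γ 1 (-(z * σ ^ γ)) := by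
    have : mittagLeffler γ 1 (-z) * γ⁻¹
        = ∫ σ in Ioo (0 : ℝ) 1, (1 - σ) ^ (γ - 1) * mittagLeffler γ 1 (-z) := by
      rw [integral_mul_const, hbv]; field_simp
    rw [this]
    refine setIntegral_mono_on (hb.mul_const _) hi measurableSet_Ioo fun σ hσ => ?_
    refine mul_le_mul_of_nonneg_left ?_ (Real.rpow_nonneg (by linarith [hσ.2]) _)
    exact mittagLeffler_neg_antitone hγ0 hγ1 (mul_nonneg hz (Real.rpow_nonneg hσ.1.le _))
      (mul_le_of_le_one_right hz (Real.rpow_le_one hσ.1.le hσ.2.le hγ0.le))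
  have h1 := mul_le_mul_of_nonneg_left hI hz
  rw [he] at h1
  rw [Real.Gamma_add_one hγ0.ne']
  have h2 : mittagLeffler γ 1 (-z) * (z / (γ * Real.Gamma γ))
      = z * (mittagLeffler γ 1 (-z) * γ⁻¹) / Real.Gamma γ := by field_simp
  have h3 : z * (mittagLeffler γ 1 (-z) * γ⁻¹) / Real.Gamma γ ≤ 1 - mittagLeffler γ 1 (-z) := by
    rw [div_le_iff₀ hG]; linarith
  rw [mul_add, mul_one, h2]; linarith

lemma mittagLeffler_neg_pos {γ z : ℝ} (hγ0 : 0 < γ) (hγ1 : γ < 1) (hz : 0 ≤ z) :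
    0 < mittagLeffler γ 1 (-z) := by
  have h := one_le_mittagLeffler_mul hγ0 hγ1 hz
  have hG : 0 < Real.Gamma (1 - γ) := Real.Gamma_pos_of_pos (by linarith)
  exact pos_of_mul_pos_left (by linarith) (by positivity : 0 ≤ 1 + Real.Gamma (1 - γ) * z)

lemma mittagLeffler_neg_le_one {γ z : ℝ} (hγ0 : 0 < γ) (hγ1 : γ < 1) (hz : 0 ≤ z) :
    mittagLeffler γ 1 (-z) ≤ 1 := by
  have := mittagLeffler_neg_antitone hγ0 hγ1 le_rfl hz
  rwa [neg_zero, mittagLeffler_zero] at this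

lemma continuous_heatSymbol {γ : ℝ} (hγ0 : 0 < γ) (T : ℝ) : Continuous (heatSymbol γ T) :=
  (continuous_mittagLeffler hγ0).comp (by fun_prop)

lemma heatSymbol_pos {γ T : ℝ} (hγ0 : 0 < γ) (hγ1 : γ < 1) (hT : 0 < T) (ω : ℝ) :
    0 < heatSymbol γ T ω := mittagLeffler_neg_pos hγ0 hγ1 (by positivity)

lemma heatSymbol_le_one {γ T : ℝ} (hγ0 : 0 < γ) (hγ1 : γ < 1) (hT : 0 < T) (ω : ℝ) :
    heatSymbol γ T ω ≤ 1 := mittagLeffler_neg_le_one hγ0 hγ1 (by positivity)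

/-- The symbol decays exactly like `|ω|⁻²`. -/
lemma exists_heatSymbol_bounds {γ T : ℝ} (hγ0 : 0 < γ) (hγ1 : γ < 1) (hT : 0 < T) :
    ∃ c₁ c₂ : ℝ, 0 < c₁ ∧ 0 < c₂ ∧ ∀ ω : ℝ, (heatSymbol γ T ω)⁻¹ ≤ 1 + c₁ * |ω| ^ 2 ∧
      heatSymbol γ T ω * |ω| ^ 2 ≤ c₂ := by
  have hG : 0 < Real.Gamma (1 - γ) := Real.Gamma_pos_of_pos (by linarith)
  have hG' : 0 < Real.Gamma (γ + 1) := Real.Gamma_pos_of_pos (by linarith)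
  have hTγ : 0 < T ^ γ := Real.rpow_pos_of_pos hT _
  refine ⟨Real.Gamma (1 - γ) * T ^ γ, Real.Gamma (γ + 1) / T ^ γ, by positivity, by positivity,
    fun ω => ?_⟩
  have hpos := heatSymbol_pos hγ0 hγ1 hT ω
  have h1 := one_le_mittagLeffler_mul hγ0 hγ1 (z := |ω| ^ 2 * T ^ γ) (by positivity)
  have h2 := mittagLeffler_mul_le_one hγ0 hγ1 (z := |ω| ^ 2 * T ^ γ) (by positivity)
  rw [← heatSymbol] at h1 h2
  constructor
  · rw [inv_le_iff_one_le_mul₀' hpos]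
    linarith
  · rw [le_div_iff₀ hTγ]
    have h3 : heatSymbol γ T ω * (|ω| ^ 2 * T ^ γ / Real.Gamma (γ + 1)) ≤ 1 := by linarith
    rw [← mul_div_assoc, div_le_one hG'] at h3
    linarith

/-! ### Affine changes of variables and the Fourier transform in `L²` -/

lemma map_affine_volume {c : ℝ} (hc : 0 < c) (k : ℝ) :
    Measure.map (fun x : ℝ => c * x - k) volume = ENNReal.ofReal c⁻¹ • volume := by
  have h : (fun x : ℝ => c * x - k) = (fun x => x - k) ∘ (fun x => c * x) := rfl
  rw [h, ← Measure.map_map (by fun_prop) (by fun_prop), Real.map_volume_mul_left hc.ne',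
    Measure.map_smul, map_sub_right_eq_self, abs_of_pos (inv_pos.2 hc)]

lemma quasiMeasurePreserving_affine {c : ℝ} (hc : 0 < c) (k : ℝ) :
    Measure.QuasiMeasurePreserving (fun x : ℝ => c * x - k) volume volume :=
  ⟨by fun_prop, by
    rw [map_affine_volume hc]; exact Measure.smul_absolutelyContinuous⟩

lemma eLpNorm_comp_affine {c : ℝ} (hc : 0 < c) (k : ℝ) {g : ℝ → ℂ}
    (hg : AEStronglyMeasurable g volume) :
    eLpNorm (fun x => g (c * x - k)) 2 volume
      = ENNReal.ofReal c⁻¹ ^ (1 / 2 : ℝ) * eLpNorm g 2 volume := by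
  have h := eLpNorm_map_measure (p := 2) (μ := volume) (f := fun x : ℝ => c * x - k) (g := g)
    (by rw [map_affine_volume hc]; exact hg.smul_measure _) (by fun_prop)
  rw [map_affine_volume hc, eLpNorm_smul_measure_of_ne_top (by simp)] at h
  rw [show (fun x => g (c * x - k)) = g ∘ fun x => c * x - k from rfl, ← h]
  simp

lemma eLpNorm_sub_le_add_of_middle {f g h : ℝ → ℂ} (hf : AEStronglyMeasurable f volume)
    (hg : AEStronglyMeasurable g volume) (hh : AEStronglyMeasurable h volume) :
    eLpNorm (fun x => f x - h x) 2 volume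
      ≤ eLpNorm (fun x => f x - g x) 2 volume + eLpNorm (fun x => g x - h x) 2 volume := by
  have := eLpNorm_add_le (p := 2) (hf.sub hg) (hg.sub hh) one_le_two
  rwa [sub_add_sub_cancel] at this

/-- The Schwartz function `x ↦ s f (c x - k)`. -/
noncomputable def schwartzAffine {c : ℝ} (hc : 0 < c) (k s : ℝ) (f : SchwartzMap ℝ ℂ) :
    SchwartzMap ℝ ℂ :=
  (s : ℂ) • SchwartzMap.compCLMOfContinuousLinearEquiv ℂ
    (ContinuousLinearEquiv.unitsEquivAut ℝ (Units.mk0 c hc.ne'))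
    (SchwartzMap.compSubConstCLM ℂ k f)

lemma schwartzAffine_apply {c : ℝ} (hc : 0 < c) (k s : ℝ) (f : SchwartzMap ℝ ℂ) (x : ℝ) :
    schwartzAffine hc k s f x = s * f (c * x - k) := by
  simp [schwartzAffine, mul_comm]

lemma fourier_schwartzAffine {c : ℝ} (hc : 0 < c) (k s : ℝ) (f : SchwartzMap ℝ ℂ) (ξ : ℝ) :
    (𝓕 (schwartzAffine hc k s f)) ξ = ((s * c⁻¹ : ℝ) : ℂ)
      * Complex.exp ((-2 * Real.pi * (k * (c⁻¹ * ξ)) : ℝ) * Complex.I) * (𝓕 f) (c⁻¹ * ξ) := by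
  rw [SchwartzMap.fourier_coe, SchwartzMap.fourier_coe, Real.fourier_eq', Real.fourier_eq']
  have h1 := Measure.integral_comp_mul_left (fun y : ℝ =>
    Complex.exp ((-2 * Real.pi * (y * (c⁻¹ * ξ)) : ℝ) * Complex.I) * (s * f (y - k))) c
  have h2 := integral_sub_right_eq_self (μ := volume) (fun y : ℝ =>
    Complex.exp ((-2 * Real.pi * ((y + k) * (c⁻¹ * ξ)) : ℝ) * Complex.I) * (s * f y)) k
  simp only [sub_add_cancel] at h2
  rw [h2] at h1
  have e1 : ∀ x : ℝ, Complex.exp ((-2 * Real.pi * inner ℝ x ξ : ℝ) * Complex.I)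
      • schwartzAffine hc k s f x = Complex.exp ((-2 * Real.pi * (c * x * (c⁻¹ * ξ)) : ℝ)
        * Complex.I) * (s * f (c * x - k)) := by
    intro x
    rw [schwartzAffine_apply, smul_eq_mul, real_inner_eq_re_inner, RCLike.inner_apply']
    congr 5
    simp
    field_simp
  simp_rw [e1]
  rw [h1, abs_of_pos (inv_pos.2 hc), Complex.real_smul, ← integral_const_mul, ← integral_const_mul]
  congr 1 with y
  have e2 : inner ℝ y (c⁻¹ * ξ) = y * (c⁻¹ * ξ) := by
    rw [real_inner_eq_re_inner, RCLike.inner_apply']; simp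
  rw [e2, add_mul, mul_add, Complex.ofReal_add, add_mul, Complex.exp_add]
  simp only [Complex.ofReal_mul, smul_eq_mul]
  ring

lemma eLpNorm_sub_affine_le {c : ℝ} (hc : 0 < c) (k : ℝ) {r : ℝ} {q f h F H : ℝ → ℂ}
    (hq : ∀ x, ‖q x‖ = r) (hf : AEStronglyMeasurable f volume)
    (hh : AEStronglyMeasurable h volume)
    (hF : F =ᵐ[volume] fun x => q x * f (c * x - k))
    (hH : H =ᵐ[volume] fun x => q x * h (c * x - k)) :
    eLpNorm (fun x => F x - H x) 2 volume
      ≤ ENNReal.ofReal r * ENNReal.ofReal c⁻¹ ^ (1 / 2 : ℝ)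
        * eLpNorm (fun x => f x - h x) 2 volume := by
  rw [mul_assoc, ← eLpNorm_comp_affine hc k (g := fun x => f x - h x) (hf.sub hh)]
  refine eLpNorm_le_mul_eLpNorm_of_ae_le_mul ?_ 2
  filter_upwards [hF, hH] with x h1 h2
  rw [h1, h2, ← mul_sub, norm_mul, hq]

lemma edist_eq_eLpNorm_sub (f g : L2) :
    edist f g = eLpNorm (fun x => f x - g x) 2 volume := Lp.edist_def f g

lemma edist_fourier (f g : L2) : edist (𝓕 f : L2) (𝓕 g) = edist f g :=
  (Lp.fourierTransformₗᵢ ℝ ℂ).isometry.edist_eq f g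

/-- The right-hand side of the transformation formula in `fourier_affine_ae`. -/
noncomputable def affineFourier (c k s : ℝ) (g : ℝ → ℂ) (ξ : ℝ) : ℂ :=
  ((s * c⁻¹ : ℝ) : ℂ) * Complex.exp ((-2 * Real.pi * (k * (c⁻¹ * ξ)) : ℝ) * Complex.I)
    * g (c⁻¹ * ξ)

lemma quasiMeasurePreserving_const_mul {c : ℝ} (hc : 0 < c) :
    Measure.QuasiMeasurePreserving (fun x : ℝ => c * x) volume volume := by
  simpa using quasiMeasurePreserving_affine hc 0

lemma aestronglyMeasurable_affineFourier {c : ℝ} (hc : 0 < c) (k s : ℝ) {g : ℝ → ℂ}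
    (hg : AEStronglyMeasurable g volume) : AEStronglyMeasurable (affineFourier c k s g) volume :=
  (Continuous.aestronglyMeasurable (by fun_prop)).mul
    (hg.comp_quasiMeasurePreserving (quasiMeasurePreserving_const_mul (inv_pos.2 hc)))

/-- A Schwartz approximation of `ψ` gives an approximation of both sides of the transformation
formula. -/
lemma eLpNorm_fourier_sub_affineFourier_le {c : ℝ} (hc : 0 < c) (k s : ℝ) {ψ w : L2}
    (hw : (w : ℝ → ℂ) =ᵐ[volume] fun x => (s : ℂ) * ψ (c * x - k)) (f : SchwartzMap ℝ ℂ) :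
    eLpNorm (fun ξ => (𝓕 w : L2) ξ - affineFourier c k s (𝓕 ψ : L2) ξ) 2 volume
      ≤ (ENNReal.ofReal |s| * ENNReal.ofReal c⁻¹ ^ (1 / 2 : ℝ)
        + ENNReal.ofReal |s * c⁻¹| * ENNReal.ofReal c⁻¹⁻¹ ^ (1 / 2 : ℝ))
        * edist ψ (f.toLp 2) := by
  have hci : 0 < c⁻¹ := inv_pos.2 hc
  obtain ⟨W, hW⟩ : ∃ W : L2, W = (schwartzAffine hc k s f).toLp 2 := ⟨_, rfl⟩
  obtain ⟨φ, hφ⟩ : ∃ φ : L2, φ = f.toLp 2 := ⟨_, rfl⟩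
  rw [← hφ]
  have hφf : (φ : ℝ → ℂ) =ᵐ[volume] f := by rw [hφ]; exact f.coeFn_toLp 2 volume
  have hWφ : (W : ℝ → ℂ) =ᵐ[volume] fun x => (s : ℂ) * φ (c * x - k) := by
    have h1 := (schwartzAffine hc k s f).coeFn_toLp 2 volume
    rw [← hW] at h1
    filter_upwards [h1, (quasiMeasurePreserving_affine hc k).ae hφf] with x h1 h2
    rw [h1, h2, schwartzAffine_apply]
  have hFφ : ((𝓕 φ : L2) : ℝ → ℂ) =ᵐ[volume] (𝓕 f : SchwartzMap ℝ ℂ) := by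
    rw [hφ, SchwartzMap.toLp_fourier_eq]; exact (𝓕 f).coeFn_toLp 2 volume
  have hFW : ((𝓕 W : L2) : ℝ → ℂ) =ᵐ[volume] affineFourier c k s (𝓕 φ : L2) := by
    have h1 := (𝓕 (schwartzAffine hc k s f)).coeFn_toLp 2 volume
    rw [← SchwartzMap.toLp_fourier_eq, ← hW] at h1
    filter_upwards [h1, (quasiMeasurePreserving_const_mul hci).ae hFφ] with ξ h1 h2
    rw [h1, fourier_schwartzAffine, affineFourier, h2]
  have b1 : eLpNorm (fun ξ => (𝓕 w : L2) ξ - (𝓕 W : L2) ξ) 2 volume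
      ≤ ENNReal.ofReal |s| * ENNReal.ofReal c⁻¹ ^ (1 / 2 : ℝ) * edist ψ φ := by
    rw [← edist_eq_eLpNorm_sub, edist_fourier, edist_eq_eLpNorm_sub, edist_eq_eLpNorm_sub]
    refine eLpNorm_sub_affine_le hc k (q := fun _ => s) (fun x => ?_)
      (Lp.aestronglyMeasurable ψ) (Lp.aestronglyMeasurable φ) hw hWφ
    rw [Complex.norm_real, Real.norm_eq_abs]
  have b2 : eLpNorm (fun ξ => (𝓕 W : L2) ξ - affineFourier c k s (𝓕 ψ : L2) ξ) 2 volume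
      ≤ ENNReal.ofReal |s * c⁻¹| * ENNReal.ofReal c⁻¹⁻¹ ^ (1 / 2 : ℝ) * edist ψ φ := by
    rw [edist_comm, ← edist_fourier, edist_eq_eLpNorm_sub]
    refine eLpNorm_sub_affine_le hci 0 (q := fun ξ => ((s * c⁻¹ : ℝ) : ℂ)
        * Complex.exp ((-2 * Real.pi * (k * (c⁻¹ * ξ)) : ℝ) * Complex.I)) (fun x => ?_)
      (Lp.aestronglyMeasurable (𝓕 φ : L2)) (Lp.aestronglyMeasurable (𝓕 ψ : L2)) ?_ ?_
    · rw [norm_mul, Complex.norm_real, Real.norm_eq_abs, Complex.norm_exp_ofReal_mul_I, mul_one]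
    · simp only [sub_zero]; exact hFW
    · simp only [sub_zero]; exact ae_eq_refl _
  refine (eLpNorm_sub_le_add_of_middle (Lp.aestronglyMeasurable (𝓕 w : L2))
    (Lp.aestronglyMeasurable (𝓕 W : L2)) (aestronglyMeasurable_affineFourier hc k s
      (Lp.aestronglyMeasurable (𝓕 ψ : L2)))).trans ?_
  rw [add_mul]
  exact add_le_add b1 b2

/-- The Fourier transform in `L²` of `x ↦ s ψ(c x - k)`; the identity for Schwartz functions
extends by density, since both sides depend continuously on `ψ`. -/
lemma fourier_affine_ae {c : ℝ} (hc : 0 < c) (k s : ℝ) {ψ w : L2}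
    (hw : (w : ℝ → ℂ) =ᵐ[volume] fun x => (s : ℂ) * ψ (c * x - k)) :
    ((𝓕 w : L2) : ℝ → ℂ) =ᵐ[volume] affineFourier c k s (𝓕 ψ : L2) := by
  obtain ⟨C, hC⟩ : ∃ C : ℝ≥0∞, C = ENNReal.ofReal |s| * ENNReal.ofReal c⁻¹ ^ (1 / 2 : ℝ)
    + ENNReal.ofReal |s * c⁻¹| * ENNReal.ofReal c⁻¹⁻¹ ^ (1 / 2 : ℝ) := ⟨_, rfl⟩
  have hCtop : C ≠ ⊤ := by
    have : ∀ r : ℝ, ENNReal.ofReal r ^ (1 / 2 : ℝ) ≠ ⊤ := fun r =>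
      ENNReal.rpow_ne_top_of_nonneg (by norm_num) ENNReal.ofReal_ne_top
    rw [hC]
    exact ENNReal.add_ne_top.2 ⟨ENNReal.mul_ne_top ENNReal.ofReal_ne_top (this _),
      ENNReal.mul_ne_top ENNReal.ofReal_ne_top (this _)⟩
  obtain ⟨d, hd⟩ : ∃ d : ℝ≥0∞, d =
    eLpNorm (fun ξ => (𝓕 w : L2) ξ - affineFourier c k s (𝓕 ψ : L2) ξ) 2 volume := ⟨_, rfl⟩
  have key : ∀ φ : L2, d ≤ C * edist ψ φ := by
    intro φ
    refine (SchwartzMap.denseRange_toLpCLM (E := ℝ) (F := ℂ) (p := 2) (μ := volume)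
      ENNReal.ofNat_ne_top).induction_on (p := fun φ => d ≤ C * edist ψ φ) φ ?_ ?_
    · exact isClosed_le continuous_const
        ((ENNReal.continuous_const_mul hCtop).comp (continuous_const.edist continuous_id))
    · intro f
      rw [hd, hC]
      exact eLpNorm_fourier_sub_affineFourier_le hc k s hw f
  have h0 := key ψ
  rw [edist_self, mul_zero, nonpos_iff_eq_zero, hd] at h0
  have h1 := (eLpNorm_eq_zero_iff ((Lp.aestronglyMeasurable (𝓕 w : L2)).sub
    (aestronglyMeasurable_affineFourier hc k s (Lp.aestronglyMeasurable (𝓕 ψ : L2))))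
    (by norm_num : (2 : ℝ≥0∞) ≠ 0)).1 h0
  filter_upwards [h1] with ξ hξ using sub_eq_zero.1 hξ

/-- The Fourier transform of a wavelet of scale `j` lives in the annulus dilated by `2 ^ j`. -/
lemma fourierSupportedIn_wavelet {ψ : L2} {u : HilbertBasis (ℤ × ℤ) ℂ L2}
    (hu : IsWaveletBasis ψ u) {a b : ℝ} (hψ : FourierSupportedIn ψ a b) (l : ℤ × ℤ) :
    FourierSupportedIn (u l) ((2 : ℝ) ^ l.1 * a) ((2 : ℝ) ^ l.1 * b) := by
  have hc : (0 : ℝ) < 2 ^ l.1 := by positivity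
  filter_upwards [fourier_affine_ae hc l.2 _ (hu l),
    (quasiMeasurePreserving_const_mul (inv_pos.2 hc)).ae hψ] with ξ h1 h2 h3
  rw [h1, affineFourier] at h3
  have h4 := h2 (right_ne_zero_of_mul h3)
  have h5 : |2 * Real.pi * (((2 : ℝ) ^ l.1)⁻¹ * ξ)| = ((2 : ℝ) ^ l.1)⁻¹ * |2 * Real.pi * ξ| := by
    rw [mul_left_comm, abs_mul, abs_of_pos (inv_pos.2 hc)]
  rw [h5] at h4
  exact ⟨(le_inv_mul_iff₀ hc).1 h4.1, (inv_mul_le_iff₀ hc).1 h4.2⟩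

/-! ### Fourier multipliers, the forward operator and the vaguelettes -/

lemma norm_sq_eq_integral (f : L2) : ‖f‖ ^ 2 = ∫ ξ, ‖f ξ‖ ^ 2 := by
  have h := inner_self_eq_norm_sq_to_K (𝕜 := ℂ) f
  rw [L2.inner_def] at h
  simp_rw [inner_self_eq_norm_sq_to_K] at h
  have h2 : ((∫ ξ, ‖f ξ‖ ^ 2 : ℝ) : ℂ) = ((‖f‖ ^ 2 : ℝ) : ℂ) := by
    rw [← integral_complex_ofReal]; push_cast; exact h
  exact_mod_cast h2.symm

lemma integrable_norm_sq (f : L2) : Integrable (fun ξ => ‖f ξ‖ ^ 2) volume :=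
  (memLp_two_iff_integrable_sq_norm (Lp.aestronglyMeasurable f)).1 (Lp.memLp f)

/-- A multiplier may be unbounded as long as it is bounded where `f` does not vanish. -/
lemma memLp_mul_of_bounded {m : ℝ → ℝ} (hm : Measurable m) {f : L2} {C : ℝ}
    (hC : ∀ᵐ ξ, f ξ ≠ 0 → |m ξ| ≤ C) :
    MemLp (fun ξ => (m ξ : ℂ) * f ξ) 2 (volume : Measure ℝ) := by
  refine (Lp.memLp f).of_le_mul (c := C)
    ((Complex.measurable_ofReal.comp hm).aestronglyMeasurable.mul (Lp.aestronglyMeasurable f)) ?_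
  filter_upwards [hC] with ξ h
  rw [norm_mul, Complex.norm_real, Real.norm_eq_abs]
  by_cases h0 : f ξ = 0
  · simp [h0]
  · exact mul_le_mul_of_nonneg_right (h h0) (norm_nonneg _)

lemma mulL2_coeFn {m : ℝ → ℝ} {f : L2}
    (h : MemLp (fun ξ => (m ξ : ℂ) * f ξ) 2 (volume : Measure ℝ)) :
    (mulL2 m f : ℝ → ℂ) =ᵐ[volume] fun ξ => (m ξ : ℂ) * f ξ := by
  rw [mulL2, dif_pos h]
  exact h.coeFn_toLp

lemma fourier_fourierMultiplier (m : ℝ → ℝ) (f : L2) :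
    𝓕 (fourierMultiplier m f) = mulL2 (fun ξ => m (2 * Real.pi * ξ)) (𝓕 f) := by
  rw [fourierMultiplier, FourierTransform.fourier_fourierInv_eq]

lemma fourier_fourierMultiplier_ae {m : ℝ → ℝ} (hm : Measurable m) {f : L2} {C : ℝ}
    (hC : ∀ᵐ ξ, (𝓕 f : L2) ξ ≠ 0 → |m (2 * Real.pi * ξ)| ≤ C) :
    ((𝓕 (fourierMultiplier m f) : L2) : ℝ → ℂ) =ᵐ[volume]
      fun ξ => (m (2 * Real.pi * ξ) : ℂ) * (𝓕 f : L2) ξ := by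
  rw [fourier_fourierMultiplier]
  exact mulL2_coeFn (memLp_mul_of_bounded (m := fun ξ => m (2 * Real.pi * ξ))
    (hm.comp (by fun_prop)) hC)

lemma norm_fourierMultiplier_le {m : ℝ → ℝ} (hm : Measurable m) {f : L2} {C : ℝ}
    (hC : ∀ᵐ ξ, (𝓕 f : L2) ξ ≠ 0 → |m (2 * Real.pi * ξ)| ≤ C) :
    ‖fourierMultiplier m f‖ ≤ C * ‖f‖ := by
  rw [← Lp.norm_fourier_eq, ← Lp.norm_fourier_eq f]
  refine Lp.norm_le_mul_norm_of_ae_le_mul ?_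
  filter_upwards [fourier_fourierMultiplier_ae hm hC, hC] with ξ h1 h2
  rw [h1, norm_mul, Complex.norm_real, Real.norm_eq_abs]
  by_cases h0 : (𝓕 f : L2) ξ = 0
  · simp [h0]
  · exact mul_le_mul_of_nonneg_right (h2 h0) (norm_nonneg _)

section Forward

variable {γ T : ℝ}

lemma fourier_forwardOp_ae (hγ0 : 0 < γ) (hγ1 : γ < 1) (hT : 0 < T) (f : L2) :
    ((𝓕 (forwardOp γ T f) : L2) : ℝ → ℂ) =ᵐ[volume]
      fun ξ => (heatSymbol γ T (2 * Real.pi * ξ) : ℂ) * (𝓕 f : L2) ξ := by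
  refine fourier_fourierMultiplier_ae (C := 1) (continuous_heatSymbol hγ0 T).measurable
    (ae_of_all _ fun ξ _ => ?_)
  rw [abs_of_pos (heatSymbol_pos hγ0 hγ1 hT _)]
  exact heatSymbol_le_one hγ0 hγ1 hT _

lemma eq_of_fourier_ae_eq {f g : L2} (h : ((𝓕 f : L2) : ℝ → ℂ) =ᵐ[volume] (𝓕 g : L2)) :
    f = g :=
  (Lp.fourierTransformₗᵢ ℝ ℂ).injective (Lp.ext h)

lemma isLinearMap_forwardOp (hγ0 : 0 < γ) (hγ1 : γ < 1) (hT : 0 < T) :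
    IsLinearMap ℂ (forwardOp γ T) where
  map_add f g := by
    refine eq_of_fourier_ae_eq ?_
    have e1 : (𝓕 (forwardOp γ T f + forwardOp γ T g) : L2)
        = 𝓕 (forwardOp γ T f) + 𝓕 (forwardOp γ T g) := FourierTransform.fourier_add _ _
    have e2 : (𝓕 (f + g) : L2) = 𝓕 f + 𝓕 g := FourierTransform.fourier_add _ _
    rw [e1]
    have h := fourier_forwardOp_ae hγ0 hγ1 hT (f + g)
    rw [e2] at h
    filter_upwards [h, fourier_forwardOp_ae hγ0 hγ1 hT f, fourier_forwardOp_ae hγ0 hγ1 hT g,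
      Lp.coeFn_add (𝓕 f : L2) (𝓕 g),
      Lp.coeFn_add (𝓕 (forwardOp γ T f) : L2) (𝓕 (forwardOp γ T g))] with ξ h0 h1 h2 h3 h4
    rw [h0, h4, Pi.add_apply, h1, h2, h3, Pi.add_apply, mul_add]
  map_smul c f := by
    refine eq_of_fourier_ae_eq ?_
    have e1 : (𝓕 (c • forwardOp γ T f) : L2) = c • 𝓕 (forwardOp γ T f) :=
      FourierTransform.fourier_smul _ _
    have e2 : (𝓕 (c • f) : L2) = c • 𝓕 f := FourierTransform.fourier_smul _ _
    rw [e1]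
    have h := fourier_forwardOp_ae hγ0 hγ1 hT (c • f)
    rw [e2] at h
    filter_upwards [h, fourier_forwardOp_ae hγ0 hγ1 hT f, Lp.coeFn_smul c (𝓕 f : L2),
      Lp.coeFn_smul c (𝓕 (forwardOp γ T f) : L2)] with ξ h0 h1 h3 h4
    rw [h0, h4, Pi.smul_apply, h1, h3, Pi.smul_apply, smul_eq_mul, smul_eq_mul]
    ring

/-- The forward operator is selfadjoint and, its symbol being positive, injective; therefore its
range is dense. -/
lemma closure_range_forwardOp (hγ0 : 0 < γ) (hγ1 : γ < 1) (hT : 0 < T) :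
    closure (Set.range (forwardOp γ T)) = univ := by
  set K : L2 →ₗ[ℂ] L2 := (isLinearMap_forwardOp hγ0 hγ1 hT).mk' _ with hK
  have hrange : Set.range (forwardOp γ T) = (LinearMap.range K : Set L2) := by
    ext; simp [hK]
  rw [hrange, ← Submodule.topologicalClosure_coe]
  have : (LinearMap.range K).topologicalClosure = ⊤ := by
    rw [Submodule.topologicalClosure_eq_top_iff, Submodule.eq_bot_iff]
    intro z hz
    have h0 : inner ℂ (forwardOp γ T z) z = 0 :=
      (Submodule.mem_orthogonal _ _).1 hz _ ⟨z, rfl⟩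
    rw [← Lp.inner_fourier_eq, L2.inner_def] at h0
    have h1 : ∫ ξ, heatSymbol γ T (2 * Real.pi * ξ) * ‖(𝓕 z : L2) ξ‖ ^ 2 = 0 := by
      have : ((∫ ξ, heatSymbol γ T (2 * Real.pi * ξ) * ‖(𝓕 z : L2) ξ‖ ^ 2 : ℝ) : ℂ) = 0 := by
        rw [← integral_complex_ofReal, ← h0]
        refine integral_congr_ae ?_
        filter_upwards [fourier_forwardOp_ae hγ0 hγ1 hT z] with ξ hξ
        rw [hξ, RCLike.inner_apply, map_mul, Complex.conj_ofReal]
        push_cast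
        rw [← Complex.mul_conj']
        ring
      exact_mod_cast this
    have hint : Integrable
        (fun ξ => heatSymbol γ T (2 * Real.pi * ξ) * ‖(𝓕 z : L2) ξ‖ ^ 2) volume := by
      refine (integrable_norm_sq (𝓕 z)).bdd_mul (c := 1)
        ((continuous_heatSymbol hγ0 T).comp (by fun_prop)).aestronglyMeasurable
        (ae_of_all _ fun ξ => ?_)
      rw [Real.norm_of_nonneg (heatSymbol_pos hγ0 hγ1 hT _).le]
      exact heatSymbol_le_one hγ0 hγ1 hT _
    rw [integral_eq_zero_iff_of_nonneg
      (fun ξ => mul_nonneg (heatSymbol_pos hγ0 hγ1 hT _).le (by positivity)) hint] at h1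
    have h2 : (𝓕 z : L2) = 0 := by
      refine Lp.eq_zero_iff_ae_eq_zero.2 ?_
      filter_upwards [h1] with ξ hξ
      have := (mul_eq_zero.1 hξ).resolve_left (heatSymbol_pos hγ0 hγ1 hT _).ne'
      simpa using this
    have h3 := Lp.norm_fourier_eq z
    rw [h2, norm_zero] at h3
    exact norm_eq_zero.1 h3.symm
  rw [this]; rfl

end Forward

lemma kappa_pos (l : ℤ × ℤ) : 0 < kappa l := by
  unfold kappa; split_ifs <;> positivity

lemma kappa_le_one (l : ℤ × ℤ) : kappa l ≤ 1 := by
  unfold kappa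
  split_ifs with h
  · exact zpow_le_one_of_nonpos₀ (by norm_num) (by omega)
  · exact le_rfl

lemma kappa_of_one_le {l : ℤ × ℤ} (h : 1 ≤ l.1) : kappa l = (((2 : ℝ) ^ l.1) ^ 2)⁻¹ := by
  rw [kappa, if_pos h, ← zpow_natCast, ← zpow_mul, ← zpow_neg]
  congr 1; push_cast; ring

lemma kappa_mul_sq_le_one (l : ℤ × ℤ) : kappa l * ((2 : ℝ) ^ l.1) ^ 2 ≤ 1 := by
  by_cases h : 1 ≤ l.1
  · rw [kappa_of_one_le h, inv_mul_cancel₀ (by positivity)]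
  · rw [kappa, if_neg h, one_mul]
    exact pow_le_one₀ (by positivity) (zpow_le_one_of_nonpos₀ (by norm_num) (by omega))

section Vaguelettes

variable {γ T a b : ℝ} {ψ : L2} {u : HilbertBasis (ℤ × ℤ) ℂ L2}

/-- On the frequency support of the wavelets of scale `j` the quotient `κ / E_{γ,1}` is bounded
uniformly in `j`. -/
lemma exists_kappa_div_heatSymbol_le (hγ0 : 0 < γ) (hγ1 : γ < 1) (hT : 0 < T) (b : ℝ) :
    ∃ C : ℝ, 0 < C ∧ ∀ (l : ℤ × ℤ) (ω : ℝ), |ω| ≤ (2 : ℝ) ^ l.1 * b →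
      |kappa l * (heatSymbol γ T ω)⁻¹| ≤ C := by
  obtain ⟨c₁, c₂, h1, h2, hb⟩ := exists_heatSymbol_bounds hγ0 hγ1 hT
  refine ⟨1 + c₁ * b ^ 2, by positivity, fun l ω hω => ?_⟩
  have hk := kappa_pos l
  have hs := heatSymbol_pos hγ0 hγ1 hT ω
  rw [abs_of_pos (by positivity)]
  calc kappa l * (heatSymbol γ T ω)⁻¹
      ≤ kappa l * (1 + c₁ * ((2 : ℝ) ^ l.1 * b) ^ 2) := by
        gcongr
        exact (hb ω).1.trans (by gcongr)
    _ = kappa l + c₁ * b ^ 2 * (kappa l * ((2 : ℝ) ^ l.1) ^ 2) := by ring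
    _ ≤ 1 + c₁ * b ^ 2 * 1 := by
        gcongr
        · exact kappa_le_one l
        · exact kappa_mul_sq_le_one l
    _ = _ := by ring

lemma fourier_vaguelette_ae (hγ0 : 0 < γ) (hγ1 : γ < 1) (hT : 0 < T) (hu : IsWaveletBasis ψ u)
    (hψ : FourierSupportedIn ψ a b) (l : ℤ × ℤ) :
    ((𝓕 (vaguelette γ T u l) : L2) : ℝ → ℂ) =ᵐ[volume] fun ξ =>
      ((kappa l * (heatSymbol γ T (2 * Real.pi * ξ))⁻¹ : ℝ) : ℂ) * (𝓕 (u l) : L2) ξ := by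
  obtain ⟨C, -, hC⟩ := exists_kappa_div_heatSymbol_le hγ0 hγ1 hT b
  refine fourier_fourierMultiplier_ae (C := C)
    ((continuous_heatSymbol hγ0 T).measurable.inv.const_mul _) ?_
  filter_upwards [fourierSupportedIn_wavelet hu hψ l] with ξ hξ h0
  exact hC l _ (hξ h0).2

/-- The quasi-singular value relation `K* v_l = κ_l u_l`. -/
lemma inner_vaguelette_forwardOp (hγ0 : 0 < γ) (hγ1 : γ < 1) (hT : 0 < T)
    (hu : IsWaveletBasis ψ u) (hψ : FourierSupportedIn ψ a b) (l : ℤ × ℤ) (x : L2) :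
    inner ℂ (vaguelette γ T u l) (forwardOp γ T x) = (kappa l : ℂ) * inner ℂ (u l) x := by
  rw [← Lp.inner_fourier_eq, ← Lp.inner_fourier_eq (u l), L2.inner_def, L2.inner_def,
    ← integral_const_mul]
  refine integral_congr_ae ?_
  filter_upwards [fourier_vaguelette_ae hγ0 hγ1 hT hu hψ l, fourier_forwardOp_ae hγ0 hγ1 hT x]
    with ξ h1 h2
  have hs : (heatSymbol γ T (2 * Real.pi * ξ) : ℂ) ≠ 0 :=
    Complex.ofReal_ne_zero.2 (heatSymbol_pos hγ0 hγ1 hT _).ne'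
  rw [h1, h2, RCLike.inner_apply, RCLike.inner_apply, map_mul, Complex.conj_ofReal]
  push_cast
  field_simp

/-- The smoothing of the forward operator on wavelets of a fine scale. -/
lemma exists_norm_forwardOp_wavelet_le (hγ0 : 0 < γ) (hγ1 : γ < 1) (hT : 0 < T)
    (hu : IsWaveletBasis ψ u) (ha : 0 < a) (hψ : FourierSupportedIn ψ a b) :
    ∃ C : ℝ, 0 < C ∧ ∀ l : ℤ × ℤ, 1 ≤ l.1 → ‖forwardOp γ T (u l)‖ ≤ C * kappa l := by
  obtain ⟨c₁, c₂, h1, h2, hb⟩ := exists_heatSymbol_bounds hγ0 hγ1 hT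
  refine ⟨c₂ / a ^ 2, by positivity, fun l hl => ?_⟩
  have hn : ‖u l‖ = 1 := u.orthonormal.norm_eq_one l
  rw [← mul_one (_ * kappa l), ← hn]
  refine norm_fourierMultiplier_le (continuous_heatSymbol hγ0 T).measurable ?_
  filter_upwards [fourierSupportedIn_wavelet hu hψ l] with ξ hξ h0
  obtain ⟨hω, -⟩ := hξ h0
  have hs := heatSymbol_pos hγ0 hγ1 hT (2 * Real.pi * ξ)
  have h2l : (0 : ℝ) < 2 ^ l.1 := by positivity
  rw [abs_of_pos hs, kappa_of_one_le hl, ← div_eq_mul_inv, div_div, ← mul_pow,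
    le_div_iff₀ (by positivity)]
  calc heatSymbol γ T (2 * Real.pi * ξ) * (a * 2 ^ l.1) ^ 2
      ≤ heatSymbol γ T (2 * Real.pi * ξ) * |2 * Real.pi * ξ| ^ 2 := by
        gcongr; rwa [mul_comm]
    _ ≤ c₂ := (hb _).2

/-- Each frequency belongs to a bounded number of the dyadic annuli. -/
lemma exists_card_annuli_le (ha : 0 < a) (b : ℝ) :
    ∃ N : ℕ, ∀ (J : Finset ℤ) (t : ℝ),
      (J.filter fun j : ℤ => (2 : ℝ) ^ j * a ≤ t ∧ t ≤ (2 : ℝ) ^ j * b).card ≤ N := by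
  obtain ⟨N, hN⟩ := pow_unbounded_of_one_lt (b / a) (one_lt_two (α := ℝ))
  refine ⟨N, fun J t => ?_⟩
  set S := J.filter fun j : ℤ => (2 : ℝ) ^ j * a ≤ t ∧ t ≤ (2 : ℝ) ^ j * b with hS
  rcases S.eq_empty_or_nonempty with h | h
  · simp [h]
  · have hsub : S ⊆ Finset.Ico (S.min' h) (S.min' h + N) := by
      intro j hj
      refine Finset.mem_Ico.2 ⟨S.min'_le j hj, ?_⟩
      have h1 := (Finset.mem_filter.1 hj).2.1
      have h2 := (Finset.mem_filter.1 (S.min'_mem h)).2.2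
      have h3 : (2 : ℝ) ^ j * a < (2 : ℝ) ^ (S.min' h + N) * a := by
        calc (2 : ℝ) ^ j * a ≤ (2 : ℝ) ^ (S.min' h) * b := h1.trans h2
          _ < (2 : ℝ) ^ (S.min' h) * (2 ^ N * a) := by
            gcongr; exact (div_lt_iff₀ ha).1 hN
          _ = _ := by rw [zpow_add₀ (by norm_num), zpow_natCast]; ring
      exact (zpow_lt_zpow_iff_right₀ one_lt_two).1 (lt_of_mul_lt_mul_right h3 ha.le)
    simpa using Finset.card_le_card hsub

/-- Upper frame bound for the vaguelettes.  Within one scale this is Bessel's inequality for the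
function with Fourier transform `κ E_{γ,1}⁻¹ 𝓕 z`, cut off to the annulus of that scale; the sum
over the scales is controlled by the finite overlap of the annuli. -/
lemma exists_isUpperFrameBound_vaguelette (hγ0 : 0 < γ) (hγ1 : γ < 1) (hT : 0 < T)
    (hu : IsWaveletBasis ψ u) (ha : 0 < a) (hψ : FourierSupportedIn ψ a b) :
    ∃ B : ℝ, IsUpperFrameBound (vaguelette γ T u) univ B := by
  obtain ⟨C, hC0, hC⟩ := exists_kappa_div_heatSymbol_le hγ0 hγ1 hT b
  obtain ⟨N, hN⟩ := exists_card_annuli_le ha b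
  set A : ℤ → Set ℝ := fun j =>
    {ξ | (2 : ℝ) ^ j * a ≤ |2 * Real.pi * ξ| ∧ |2 * Real.pi * ξ| ≤ (2 : ℝ) ^ j * b} with hA
  have hAm : ∀ j, MeasurableSet (A j) := fun j =>
    (by fun_prop : Measurable fun ξ : ℝ => |2 * Real.pi * ξ|) measurableSet_Icc
  have hscale : ∀ (z : L2) (j : ℤ) (s : Finset ℤ),
      ∑ k ∈ s, ‖inner ℂ (vaguelette γ T u (j, k)) z‖ ^ 2
        ≤ C ^ 2 * ∫ ξ, (A j).indicator (fun ξ => ‖(𝓕 z : L2) ξ‖ ^ 2) ξ := by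
    intro z j s
    set m : ℝ → ℝ := (A j).indicator
      fun ξ => kappa (j, 0) * (heatSymbol γ T (2 * Real.pi * ξ))⁻¹ with hm
    have hmm : Measurable m := by
      refine Measurable.indicator ?_ (hAm j)
      exact (((continuous_heatSymbol hγ0 T).measurable.comp (by fun_prop)).inv).const_mul _
    have hmC : ∀ ξ, |m ξ| ≤ C := by
      intro ξ
      by_cases h : ξ ∈ A j
      · rw [hm, indicator_of_mem h]; exact hC (j, 0) _ h.2
      · rw [hm, indicator_of_notMem h, abs_zero]; exact hC0.le
    have hcoe : (mulL2 m (𝓕 z) : ℝ → ℂ) =ᵐ[volume] fun ξ => (m ξ : ℂ) * (𝓕 z : L2) ξ :=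
      mulL2_coeFn (memLp_mul_of_bounded hmm (ae_of_all _ fun ξ _ => hmC ξ))
    set h : L2 := 𝓕⁻ (mulL2 m (𝓕 z)) with hh
    have hFh : (𝓕 h : L2) = mulL2 m (𝓕 z) := FourierTransform.fourier_fourierInv_eq _
    have hinner : ∀ k, inner ℂ (vaguelette γ T u (j, k)) z = inner ℂ (u (j, k)) h := by
      intro k
      rw [← Lp.inner_fourier_eq, ← Lp.inner_fourier_eq (u _), hFh, L2.inner_def, L2.inner_def]
      refine integral_congr_ae ?_
      filter_upwards [fourier_vaguelette_ae hγ0 hγ1 hT hu hψ (j, k), hcoe,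
        fourierSupportedIn_wavelet hu hψ (j, k)] with ξ h1 h2 h3
      rw [h1, h2, RCLike.inner_apply, RCLike.inner_apply, map_mul, Complex.conj_ofReal]
      by_cases h0 : (𝓕 (u (j, k)) : L2) ξ = 0
      · simp [h0]
      · rw [hm, indicator_of_mem (show ξ ∈ A j from h3 h0)]
        have : kappa (j, k) = kappa (j, 0) := rfl
        rw [this]; ring
    have horth : Orthonormal ℂ fun k => u (j, k) :=
      u.orthonormal.comp _ (Prod.mk_right_injective j)
    calc ∑ k ∈ s, ‖inner ℂ (vaguelette γ T u (j, k)) z‖ ^ 2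
        = ∑ k ∈ s, ‖inner ℂ (u (j, k)) h‖ ^ 2 := by simp_rw [hinner]
      _ ≤ ‖h‖ ^ 2 := horth.sum_inner_products_le h
      _ = ∫ ξ, ‖mulL2 m (𝓕 z) ξ‖ ^ 2 := by
          rw [← Lp.norm_fourier_eq, hFh, norm_sq_eq_integral]
      _ ≤ ∫ ξ, C ^ 2 * (A j).indicator (fun ξ => ‖(𝓕 z : L2) ξ‖ ^ 2) ξ := by
          refine integral_mono_ae (integrable_norm_sq _)
            (((integrable_norm_sq (𝓕 z)).indicator (hAm j)).const_mul _) ?_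
          filter_upwards [hcoe] with ξ h1
          rw [h1, norm_mul, mul_pow, Complex.norm_real, Real.norm_eq_abs]
          by_cases h : ξ ∈ A j
          · rw [indicator_of_mem h]
            gcongr; exact hmC ξ
          · rw [indicator_of_notMem h, hm, indicator_of_notMem h]; simp
      _ = _ := integral_const_mul _ _
  have hfin : ∀ (z : L2) (s : Finset (ℤ × ℤ)),
      ∑ l ∈ s, ‖inner ℂ (vaguelette γ T u l) z‖ ^ 2 ≤ C ^ 2 * (N + 1) * ‖z‖ ^ 2 := by
    intro z s
    set J := s.image Prod.fst
    set L := s.image Prod.snd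
    calc ∑ l ∈ s, ‖inner ℂ (vaguelette γ T u l) z‖ ^ 2
        ≤ ∑ l ∈ J ×ˢ L, ‖inner ℂ (vaguelette γ T u l) z‖ ^ 2 :=
          Finset.sum_le_sum_of_subset_of_nonneg Finset.subset_product fun _ _ _ => by positivity
      _ = ∑ j ∈ J, ∑ k ∈ L, ‖inner ℂ (vaguelette γ T u (j, k)) z‖ ^ 2 := Finset.sum_product _ _ _
      _ ≤ ∑ j ∈ J, C ^ 2 * ∫ ξ, (A j).indicator (fun ξ => ‖(𝓕 z : L2) ξ‖ ^ 2) ξ :=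
          Finset.sum_le_sum fun j _ => hscale z j L
      _ = C ^ 2 * ∫ ξ, ∑ j ∈ J, (A j).indicator (fun ξ => ‖(𝓕 z : L2) ξ‖ ^ 2) ξ := by
          rw [← Finset.mul_sum, integral_finsetSum _ fun j _ =>
            (integrable_norm_sq (𝓕 z)).indicator (hAm j)]
      _ ≤ C ^ 2 * ∫ ξ, (N + 1) * ‖(𝓕 z : L2) ξ‖ ^ 2 := by
          gcongr
          · exact integrable_finsetSum _ fun j _ => (integrable_norm_sq (𝓕 z)).indicator (hAm j)
          · exact (integrable_norm_sq (𝓕 z)).const_mul _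
          · intro ξ
            simp only [indicator_apply]
            rw [← Finset.sum_filter, Finset.sum_const, nsmul_eq_mul]
            gcongr
            have h1 := hN J |2 * Real.pi * ξ|
            have h2 : ((J.filter fun j => ξ ∈ A j).card : ℝ) ≤ N := by exact_mod_cast h1
            linarith
      _ = C ^ 2 * (N + 1) * ‖z‖ ^ 2 := by
          rw [integral_const_mul, ← norm_sq_eq_integral, Lp.norm_fourier_eq]; ring
  refine ⟨C ^ 2 * (N + 1), by positivity, fun z _ => ⟨?_, ?_⟩⟩
  · exact summable_of_sum_le (fun _ => by positivity) (hfin z)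
  · exact Real.tsum_le_of_sum_le (fun _ => by positivity) (hfin z)

end Vaguelettes

/-! ### Coefficients with respect to a Hilbert basis -/

section Abstract

variable {ι X Y : Type*} [NormedAddCommGroup X] [InnerProductSpace ℂ X]
  [NormedAddCommGroup Y] [InnerProductSpace ℂ Y]

lemma HilbertBasis.hasSum_norm_inner_sq (u : HilbertBasis ι ℂ X) (x : X) :
    HasSum (fun l => ‖inner ℂ (u l) x‖ ^ 2) (‖x‖ ^ 2) := by
  have h := lp.hasSum_norm (p := 2) (by simp) (u.repr x)
  simp only [ENNReal.toReal_ofNat, Real.rpow_ofNat, u.repr.norm_map, u.repr_apply_apply] at h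
  exact h

/-- Riesz–Fischer: a square-summable family is the family of coefficients of a vector. -/
lemma HilbertBasis.exists_hasSum_of_summable_sq (u : HilbertBasis ι ℂ X) {a : ι → ℂ}
    (ha : Summable fun l => ‖a l‖ ^ 2) :
    ∃ x : X, HasSum (fun l => a l • u l) x ∧ ∀ l, inner ℂ (u l) x = a l := by
  have hmem : Memℓp a 2 := memℓp_gen (by simpa using ha)
  refine ⟨u.repr.symm ⟨a, hmem⟩, u.hasSum_repr_symm ⟨a, hmem⟩, fun l => ?_⟩
  rw [← u.repr_apply_apply, LinearIsometryEquiv.apply_symm_apply]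

lemma HilbertBasis.ext_inner (u : HilbertBasis ι ℂ X) {x y : X}
    (h : ∀ l, inner ℂ (u l) x = inner ℂ (u l) y) : x = y := by
  refine u.repr.injective (lp.ext (funext fun l => ?_))
  rw [u.repr_apply_apply, u.repr_apply_apply, h]

/-! ### Filter estimates -/

/-- The Tikhonov residual factor `α / (α + κ²)`. -/
noncomputable def tikhonovResidual (α κ : ℝ) : ℝ := α / (α + κ ^ 2)

lemma tikhonovResidual_pos {α : ℝ} (hα : 0 < α) (κ : ℝ) : 0 < tikhonovResidual α κ := by
  unfold tikhonovResidual; positivity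

lemma tikhonovResidual_le_one {α : ℝ} (hα : 0 < α) (κ : ℝ) : tikhonovResidual α κ ≤ 1 := by
  unfold tikhonovResidual
  rw [div_le_one (by positivity)]
  nlinarith [sq_nonneg κ]

lemma mul_tikhonovFilter_sq {α κ : ℝ} (hα : 0 < α) :
    κ * (κ * tikhonovFilter α (κ ^ 2)) = 1 - tikhonovResidual α κ := by
  unfold tikhonovFilter tikhonovResidual
  have : 0 < α + κ ^ 2 := by positivity
  field_simp
  ring

lemma abs_mul_tikhonovFilter_le {α κ : ℝ} (hα : 0 < α) (hκ : 0 < κ) :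
    |κ * tikhonovFilter α (κ ^ 2)| ≤ (2 * √α)⁻¹ := by
  unfold tikhonovFilter
  have h : 0 < √α := Real.sqrt_pos.2 hα
  have h2 := Real.sq_sqrt hα.le
  rw [abs_of_pos (by positivity), mul_one_div, ← one_div, div_le_div_iff₀ (by positivity)
    (by positivity)]
  nlinarith [sq_nonneg (√α - κ)]

/-- The qualification of the Tikhonov method. -/
lemma tikhonovResidual_mul_rpow_le {α κ q : ℝ} (hα : 0 < α) (hκ : 0 < κ) (hq0 : 0 ≤ q)
    (hq : q ≤ 2) :
    tikhonovResidual α κ * κ ^ q ≤ α ^ (q / 2) := by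
  set t := κ ^ 2 / α with ht
  have ht0 : 0 < t := by positivity
  have h1 : κ ^ q = α ^ (q / 2) * t ^ (q / 2) := by
    rw [← Real.mul_rpow hα.le ht0.le, ht, mul_div_cancel₀ _ hα.ne', ← Real.rpow_natCast,
      ← Real.rpow_mul hκ.le]
    congr 1; push_cast; ring
  have h2 : tikhonovResidual α κ = (1 + t)⁻¹ := by
    unfold tikhonovResidual; rw [ht]; field_simp
  have h3 : t ^ (q / 2) ≤ 1 + t := by
    rcases le_total t 1 with h | h
    · exact (Real.rpow_le_one ht0.le h (by linarith)).trans (by linarith)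
    · have := Real.rpow_le_rpow_of_exponent_le h (by linarith : q / 2 ≤ 1)
      rw [Real.rpow_one] at this
      linarith
  rw [h1, h2, inv_mul_le_iff₀ (by positivity)]
  calc _ ≤ α ^ (q / 2) * (1 + t) := by gcongr
    _ = _ := mul_comm _ _

lemma sq_rpow_inv {κ : ℝ} (hκ : 0 < κ) (p : ℝ) : ((κ ^ 2) ^ (p / 2))⁻¹ = (κ ^ p)⁻¹ := by
  rw [← Real.rpow_natCast, ← Real.rpow_mul hκ.le]
  congr 2; push_cast; ring

/-! ### Source conditions -/

variable {κ : ι → ℝ} {u : HilbertBasis ι ℂ X} {p E : ℝ} {θ : X}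

lemma mem_sourceSet_rpow_iff (hκ : ∀ l, 0 < κ l) :
    θ ∈ sourceSet (fun μ => μ ^ (p / 2)) κ u E ↔
      Summable (fun l => (κ l ^ p)⁻¹ * ‖inner ℂ (u l) θ‖ ^ 2) ∧
        ∑' l, (κ l ^ p)⁻¹ * ‖inner ℂ (u l) θ‖ ^ 2 ≤ E ^ 2 := by
  simp only [sourceSet, mem_ofPred_eq, sq_rpow_inv (hκ _)]

/-- Damping of the source condition by coefficients `c l` with `c l * κ l ^ (p / 2) ≤ M`. -/
lemma tsum_sq_mul_le_of_mem_sourceSet (hκ : ∀ l, 0 < κ l)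
    (hθ : θ ∈ sourceSet (fun μ => μ ^ (p / 2)) κ u E) {c : ι → ℝ} {M : ℝ}
    (hc0 : ∀ l, 0 ≤ c l) (hc : ∀ l, c l * κ l ^ (p / 2) ≤ M) :
    ∑' l, c l ^ 2 * ‖inner ℂ (u l) θ‖ ^ 2 ≤ M ^ 2 * E ^ 2 := by
  obtain ⟨hs, hle⟩ := (mem_sourceSet_rpow_iff hκ).1 hθ
  have hterm : ∀ l, c l ^ 2 * ‖inner ℂ (u l) θ‖ ^ 2
      ≤ M ^ 2 * ((κ l ^ p)⁻¹ * ‖inner ℂ (u l) θ‖ ^ 2) := by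
    intro l
    have hk := Real.rpow_pos_of_pos (hκ l) p
    have h1 : (c l * κ l ^ (p / 2)) ^ 2 ≤ M ^ 2 :=
      pow_le_pow_left₀ (mul_nonneg (hc0 l) (Real.rpow_nonneg (hκ l).le _)) (hc l) 2
    have h2 : (κ l ^ (p / 2)) ^ 2 = κ l ^ p := by
      rw [← Real.rpow_natCast, ← Real.rpow_mul (hκ l).le]; congr 1; push_cast; ring
    rw [mul_pow, h2] at h1
    rw [← mul_assoc]
    gcongr
    rwa [← div_eq_mul_inv, le_div_iff₀ hk]
  calc ∑' l, c l ^ 2 * ‖inner ℂ (u l) θ‖ ^ 2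
      ≤ ∑' l, M ^ 2 * ((κ l ^ p)⁻¹ * ‖inner ℂ (u l) θ‖ ^ 2) :=
        Summable.tsum_le_tsum hterm
          (Summable.of_nonneg_of_le (fun l => by positivity) hterm (hs.mul_left _))
          (hs.mul_left _)
    _ = M ^ 2 * ∑' l, (κ l ^ p)⁻¹ * ‖inner ℂ (u l) θ‖ ^ 2 := tsum_mul_left
    _ ≤ _ := by gcongr

/-- The interpolation inequality: under the source condition, the norm of `r θ` is controlled by
that of the residual `r κ θ`, by Hölder's inequality with exponents `(p + 2) / p` and
`(p + 2) / 2`. -/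
lemma sqrt_tsum_interpolation (hκ : ∀ l, 0 < κ l) (hp : 0 < p) (hE : 0 < E)
    (hθ : θ ∈ sourceSet (fun μ => μ ^ (p / 2)) κ u E) {r : ι → ℝ} (hr0 : ∀ l, 0 ≤ r l)
    (hr1 : ∀ l, r l ≤ 1)
    (hsum : Summable fun l => (r l * κ l) ^ 2 * ‖inner ℂ (u l) θ‖ ^ 2) :
    √(∑' l, r l ^ 2 * ‖inner ℂ (u l) θ‖ ^ 2)
      ≤ √(∑' l, (r l * κ l) ^ 2 * ‖inner ℂ (u l) θ‖ ^ 2) ^ (p / (p + 2))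
        * E ^ (2 / (p + 2)) := by
  obtain ⟨hs, hle⟩ := (mem_sourceSet_rpow_iff hκ).1 hθ
  have hp2 : 0 < p + 2 := by linarith
  set s : ℝ := p / (p + 2) with hsdef
  set t : ℝ := 2 / (p + 2) with htdef
  have hs0 : 0 < s := by positivity
  have ht0 : 0 < t := by positivity
  have hst : s + t = 1 := by rw [hsdef, htdef]; field_simp
  have hconj : Real.HolderConjugate (1 / s) (1 / t) := by
    rw [Real.holderConjugate_iff]
    refine ⟨?_, by simpa using hst⟩
    rw [lt_div_iff₀ hs0]; linarith
  set f : ι → ℝ := fun l => (r l * κ l) ^ 2 * ‖inner ℂ (u l) θ‖ ^ 2 with hf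
  set g : ι → ℝ := fun l => r l ^ 2 * ((κ l ^ p)⁻¹ * ‖inner ℂ (u l) θ‖ ^ 2) with hg
  have hf0 : ∀ l, 0 ≤ f l := fun l => by positivity
  have hg0 : ∀ l, 0 ≤ g l := fun l => by
    have := Real.rpow_pos_of_pos (hκ l) p
    positivity
  have hgle : ∀ l, g l ≤ (κ l ^ p)⁻¹ * ‖inner ℂ (u l) θ‖ ^ 2 := fun l => by
    have := Real.rpow_pos_of_pos (hκ l) p
    exact mul_le_of_le_one_left (by positivity) (pow_le_one₀ (hr0 l) (hr1 l))
  have hgs : Summable g := Summable.of_nonneg_of_le hg0 hgle hs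
  have hgE : ∑' l, g l ≤ E ^ 2 := (hgs.tsum_le_tsum hgle hs).trans hle
  have hprod : ∀ l, r l ^ 2 * ‖inner ℂ (u l) θ‖ ^ 2 = f l ^ s * g l ^ t := by
    intro l
    have hk := hκ l
    have hkp := Real.rpow_pos_of_pos hk p
    have e1 : f l = κ l ^ (2 : ℝ) * (r l ^ 2 * ‖inner ℂ (u l) θ‖ ^ 2) := by
      simp only [hf, Real.rpow_ofNat]; ring
    have e2 : g l = κ l ^ (-p) * (r l ^ 2 * ‖inner ℂ (u l) θ‖ ^ 2) := by
      simp only [hg]; rw [Real.rpow_neg hk.le]; ring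
    have hw : 0 ≤ r l ^ 2 * ‖inner ℂ (u l) θ‖ ^ 2 := by positivity
    rw [e1, e2, Real.mul_rpow (by positivity) hw, Real.mul_rpow (by positivity) hw,
      mul_mul_mul_comm,
      ← Real.rpow_mul hk.le, ← Real.rpow_mul hk.le, ← Real.rpow_add hk]
    rw [← Real.rpow_add_of_nonneg hw hs0.le ht0.le, hst, Real.rpow_one]
    have : 2 * s + -p * t = 0 := by rw [hsdef, htdef]; field_simp; ring
    rw [this, Real.rpow_zero, one_mul]
  have hpow : ∀ (x e : ℝ), 0 ≤ x → 0 < e → (x ^ e) ^ (1 / e) = x := fun x e hx he => by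
    rw [← Real.rpow_mul hx, mul_one_div_cancel he.ne', Real.rpow_one]
  have hhol := Real.inner_le_Lp_mul_Lq_tsum_of_nonneg hconj (f := fun l => f l ^ s)
    (g := fun l => g l ^ t) (fun l => Real.rpow_nonneg (hf0 l) _)
    (fun l => Real.rpow_nonneg (hg0 l) _)
    (by simpa only [hpow _ _ (hf0 _) hs0] using hsum)
    (by simpa only [hpow _ _ (hg0 _) ht0] using hgs)
  simp only [hpow _ _ (hf0 _) hs0, hpow _ _ (hg0 _) ht0, one_div_one_div, ← hprod] at hhol
  calc √(∑' l, r l ^ 2 * ‖inner ℂ (u l) θ‖ ^ 2)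
      ≤ √((∑' l, f l) ^ s * (E ^ 2) ^ t) := by
        refine Real.sqrt_le_sqrt (hhol.trans ?_)
        exact mul_le_mul_of_nonneg_left (Real.rpow_le_rpow (tsum_nonneg hg0) hgE ht0.le)
          (Real.rpow_nonneg (tsum_nonneg hf0) _)
    _ = _ := by
        rw [Real.sqrt_mul (Real.rpow_nonneg (tsum_nonneg hf0) _), Real.sqrt_eq_rpow,
          Real.sqrt_eq_rpow, Real.sqrt_eq_rpow, ← Real.rpow_mul (tsum_nonneg hf0),
          ← Real.rpow_mul (tsum_nonneg hf0), ← Real.rpow_natCast, ← Real.rpow_mul hE.le,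
          ← Real.rpow_mul hE.le]
        congr 2
        · ring
        · push_cast; ring

/-! ### Regularization error -/

variable {v : ι → Y} {K : X → Y} {B δ α : ℝ} {y : Y}

lemma norm_filterCoeff_sq_le (hκ : ∀ l, 0 < κ l) (hα : 0 < α) (y : Y) (l : ι) :
    ‖((κ l * tikhonovFilter α (κ l ^ 2) : ℝ) : ℂ) * inner ℂ (v l) y‖ ^ 2
      ≤ (2 * √α)⁻¹ ^ 2 * ‖inner ℂ (v l) y‖ ^ 2 := by
  rw [norm_mul, mul_pow, Complex.norm_real, Real.norm_eq_abs]
  gcongr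
  exact abs_mul_tikhonovFilter_le hα (hκ l)

lemma summable_filterTerm_and_inner_tikhonov (hκ : ∀ l, 0 < κ l) (hα : 0 < α)
    (hy : Summable fun l => ‖inner ℂ (v l) y‖ ^ 2) :
    Summable (filterTerm (tikhonovFilter α) κ u v y) ∧
      ∀ l, inner ℂ (u l) (tikhonov κ u v α y)
        = ((κ l * tikhonovFilter α (κ l ^ 2) : ℝ) : ℂ) * inner ℂ (v l) y := by
  obtain ⟨x, hx, hxl⟩ := u.exists_hasSum_of_summable_sq
    (Summable.of_nonneg_of_le (fun l => by positivity)
      (norm_filterCoeff_sq_le (v := v) hκ hα y) (hy.mul_left _))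
  have hx' : HasSum (filterTerm (tikhonovFilter α) κ u v y) x := hx
  refine ⟨hx'.summable, fun l => ?_⟩
  rw [tikhonov, filterReconstruction, hx'.tsum_eq, hxl]

lemma summable_residual_mul (hα : 0 < α) {c : ι → ℂ} (hc : Summable fun l => ‖c l‖ ^ 2) :
    Summable fun l => tikhonovResidual α (κ l) ^ 2 * ‖c l‖ ^ 2 :=
  Summable.of_nonneg_of_le (fun l => by positivity)
    (fun l => mul_le_of_le_one_left (by positivity)
      (pow_le_one₀ (tikhonovResidual_pos hα _).le (tikhonovResidual_le_one hα _))) hc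

/-- The error splits into the propagated data error, bounded by `√B δ / (2 √α)`, and the
approximation error with coefficients `-α / (α + κ²) ⟨θ, u⟩`. -/
lemma norm_tikhonov_sub_le (hκ : ∀ l, 0 < κ l) (hα : 0 < α)
    (hK : ∀ l x, inner ℂ (v l) (K x) = (κ l : ℂ) * inner ℂ (u l) x)
    (hB : IsUpperFrameBound v univ B) (hy : ‖K θ - y‖ ≤ δ) :
    ‖tikhonov κ u v α y - θ‖ ≤ (2 * √α)⁻¹ * (√B * δ)
      + √(∑' l, tikhonovResidual α (κ l) ^ 2 * ‖inner ℂ (u l) θ‖ ^ 2) := by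
  have hBy := fun z => hB.2 z (mem_univ z)
  obtain ⟨P, -, hP⟩ := u.exists_hasSum_of_summable_sq
    (Summable.of_nonneg_of_le (fun l => by positivity)
      (norm_filterCoeff_sq_le (v := v) hκ hα (K θ - y)) ((hBy (K θ - y)).1.mul_left _))
  have hQs : Summable fun l => ‖((tikhonovResidual α (κ l) : ℝ) : ℂ) * inner ℂ (u l) θ‖ ^ 2 := by
    simp only [norm_mul, mul_pow, Complex.norm_real, Real.norm_eq_abs, sq_abs]
    exact summable_residual_mul hα (u.hasSum_norm_inner_sq θ).summable
  obtain ⟨Q, -, hQ⟩ := u.exists_hasSum_of_summable_sq hQs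
  have hsplit : tikhonov κ u v α y - θ = -(P + Q) := by
    refine u.ext_inner fun l => ?_
    rw [inner_sub_right, (summable_filterTerm_and_inner_tikhonov hκ hα (hBy y).1).2 l,
      inner_neg_right, inner_add_right, hP, hQ, inner_sub_right, hK]
    have := congrArg (fun t : ℝ => (t : ℂ)) (mul_tikhonovFilter_sq (κ := κ l) hα)
    simp only [Complex.ofReal_mul, Complex.ofReal_sub, Complex.ofReal_one] at this ⊢
    linear_combination (inner ℂ (u l) θ : ℂ) * this
  have hPn : ‖P‖ ≤ (2 * √α)⁻¹ * (√B * δ) := by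
    have h1 : ‖P‖ ^ 2 ≤ ((2 * √α)⁻¹ * (√B * ‖K θ - y‖)) ^ 2 := by
      rw [← (u.hasSum_norm_inner_sq P).tsum_eq]
      simp only [hP]
      calc _ ≤ ∑' l, (2 * √α)⁻¹ ^ 2 * ‖inner ℂ (v l) (K θ - y)‖ ^ 2 :=
            Summable.tsum_le_tsum (norm_filterCoeff_sq_le hκ hα _)
              (Summable.of_nonneg_of_le (fun l => by positivity)
                (norm_filterCoeff_sq_le (v := v) hκ hα (K θ - y)) ((hBy (K θ - y)).1.mul_left _))
              ((hBy (K θ - y)).1.mul_left _)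
        _ = (2 * √α)⁻¹ ^ 2 * ∑' l, ‖inner ℂ (v l) (K θ - y)‖ ^ 2 := tsum_mul_left
        _ ≤ (2 * √α)⁻¹ ^ 2 * (B * ‖K θ - y‖ ^ 2) := by
            gcongr; exact (hBy _).2
        _ = _ := by rw [mul_pow, mul_pow, Real.sq_sqrt hB.1.le]
    refine ((pow_le_pow_iff_left₀ (norm_nonneg _) (by positivity) two_ne_zero).1 h1).trans ?_
    gcongr
  have hQn : ‖Q‖ = √(∑' l, tikhonovResidual α (κ l) ^ 2 * ‖inner ℂ (u l) θ‖ ^ 2) := by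
    rw [← Real.sqrt_sq (norm_nonneg Q), ← (u.hasSum_norm_inner_sq Q).tsum_eq]
    simp only [hQ, norm_mul, mul_pow, Complex.norm_real, Real.norm_eq_abs, sq_abs]
  rw [hsplit, norm_neg, ← hQn]
  exact (norm_add_le _ _).trans (by gcongr)

variable {τ : ℝ}

/-! ### A priori parameter choice -/

lemma bias_rate_eq (hp : 0 < p) (hδ : 0 < δ) (hE : 0 < E) :
    (δ / E) ^ (p / (p + 2)) * E = δ ^ (p / (p + 2)) * E ^ (2 / (p + 2)) := by
  have h : E = E ^ (p / (p + 2)) * E ^ (2 / (p + 2)) := by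
    rw [← Real.rpow_add hE, ← add_div, div_self (by linarith), Real.rpow_one]
  rw [Real.div_rpow hδ.le hE.le, div_mul_eq_mul_div, div_eq_iff (by positivity)]
  nth_rw 1 [h]
  ring

lemma noise_rate_eq (hp : 0 < p) (hδ : 0 < δ) (hE : 0 < E) :
    ((δ / E) ^ (2 / (p + 2)))⁻¹ * δ = δ ^ (p / (p + 2)) * E ^ (2 / (p + 2)) := by
  have h : δ = δ ^ (p / (p + 2)) * δ ^ (2 / (p + 2)) := by
    rw [← Real.rpow_add hδ, ← add_div, div_self (by linarith), Real.rpow_one]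
  rw [Real.div_rpow hδ.le hE.le, inv_div, div_mul_eq_mul_div, div_eq_iff (by positivity)]
  nth_rw 1 [h]
  ring

lemma norm_tikhonov_apriori_sub_le (hκ : ∀ l, 0 < κ l)
    (hK : ∀ l x, inner ℂ (v l) (K x) = (κ l : ℂ) * inner ℂ (u l) x)
    (hB : IsUpperFrameBound v univ B) (hp : 0 < p) (hp4 : p ≤ 4) (hE : 0 < E) (hδ : 0 < δ)
    (hθ : θ ∈ sourceSet (fun μ => μ ^ (p / 2)) κ u E) (hy : ‖K θ - y‖ ≤ δ) :
    ‖tikhonov κ u v ((δ / E) ^ (4 / (p + 2))) y - θ‖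
      ≤ (√B / 2 + 1) * δ ^ (p / (p + 2)) * E ^ (2 / (p + 2)) := by
  have hq : 0 < δ / E := by positivity
  set α : ℝ := (δ / E) ^ (4 / (p + 2)) with hαdef
  have hα : 0 < α := by positivity
  have hsqrt : √α = (δ / E) ^ (2 / (p + 2)) := by
    rw [hαdef, Real.sqrt_eq_rpow, ← Real.rpow_mul hq.le]; congr 1; ring
  have hbias := tsum_sq_mul_le_of_mem_sourceSet hκ hθ (c := fun l => tikhonovResidual α (κ l))
    (fun l => (tikhonovResidual_pos hα _).le)
    (fun l => tikhonovResidual_mul_rpow_le hα (hκ l) (by linarith) (by linarith : p / 2 ≤ 2))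
  have hpow : α ^ (p / 2 / 2) = (δ / E) ^ (p / (p + 2)) := by
    rw [hαdef, ← Real.rpow_mul hq.le]; congr 1; field_simp; ring
  rw [hpow, ← mul_pow, bias_rate_eq hp hδ hE] at hbias
  have h1 := (norm_tikhonov_sub_le hκ hα hK hB hy).trans
    (add_le_add_right ((Real.sqrt_le_sqrt hbias).trans (Real.sqrt_sq (by positivity)).le) _)
  refine h1.trans (le_of_eq ?_)
  have h2 : (2 * √α)⁻¹ * (√B * δ) = √B / 2 * (((δ / E) ^ (2 / (p + 2)))⁻¹ * δ) := by
    rw [hsqrt, mul_inv]; ring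
  rw [h2, noise_rate_eq hp hδ hE]; ring

/-! ### The discrepancy principle -/

lemma sqrt_tsum_sq_add_le (u : HilbertBasis ι ℂ X) {a b : ι → ℂ} (ha : Summable fun l => ‖a l‖ ^ 2)
    (hb : Summable fun l => ‖b l‖ ^ 2) :
    √(∑' l, ‖a l + b l‖ ^ 2) ≤ √(∑' l, ‖a l‖ ^ 2) + √(∑' l, ‖b l‖ ^ 2) := by
  obtain ⟨x, -, hx⟩ := u.exists_hasSum_of_summable_sq ha
  obtain ⟨z, -, hz⟩ := u.exists_hasSum_of_summable_sq hb
  have h : ∀ w : X, √(∑' l, ‖inner ℂ (u l) w‖ ^ 2) = ‖w‖ := fun w => by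
    rw [(u.hasSum_norm_inner_sq w).tsum_eq, Real.sqrt_sq (norm_nonneg _)]
  have e3 := h (x + z)
  simp only [inner_add_right, hx, hz] at e3
  have e1 := h x
  have e2 := h z
  simp only [hx] at e1
  simp only [hz] at e2
  rw [e1, e2, e3]
  exact norm_add_le _ _

lemma discrepancy_eq (hκ : ∀ l, 0 < κ l) (hα : 0 < α)
    (hK : ∀ l x, inner ℂ (v l) (K x) = (κ l : ℂ) * inner ℂ (u l) x)
    (hy : Summable fun l => ‖inner ℂ (v l) y‖ ^ 2) :
    discrepancy K κ u v α y
      = √(∑' l, tikhonovResidual α (κ l) ^ 2 * ‖inner ℂ (v l) y‖ ^ 2) := by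
  unfold discrepancy
  congr 2 with l
  have : inner ℂ (v l) (K (tikhonov κ u v α y) - y)
      = ((-tikhonovResidual α (κ l) : ℝ) : ℂ) * inner ℂ (v l) y := by
    rw [inner_sub_right, hK, (summable_filterTerm_and_inner_tikhonov hκ hα hy).2 l]
    have := congrArg (fun t : ℝ => (t : ℂ)) (mul_tikhonovFilter_sq (κ := κ l) hα)
    simp only [Complex.ofReal_mul, Complex.ofReal_sub, Complex.ofReal_one,
      Complex.ofReal_neg] at this ⊢
    linear_combination (inner ℂ (v l) y : ℂ) * this
  rw [this, norm_mul, mul_pow, Complex.norm_real, Real.norm_eq_abs, sq_abs, neg_sq]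

/-- Weighted residuals of noisy and of exact data differ by at most `√B δ`. -/
lemma abs_sqrt_tsum_data_sub_le (hK : ∀ l x, inner ℂ (v l) (K x) = (κ l : ℂ) * inner ℂ (u l) x)
    (hB : IsUpperFrameBound v univ B) (hy : ‖K θ - y‖ ≤ δ) {r : ι → ℝ} (hr0 : ∀ l, 0 ≤ r l)
    (hr1 : ∀ l, r l ≤ 1) :
    |√(∑' l, r l ^ 2 * ‖inner ℂ (v l) y‖ ^ 2)
      - √(∑' l, (r l * κ l) ^ 2 * ‖inner ℂ (u l) θ‖ ^ 2)| ≤ √B * δ := by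
  have hnorm : ∀ (z : Y) (l : ι), ‖((r l : ℝ) : ℂ) * inner ℂ (v l) z‖ ^ 2
      = r l ^ 2 * ‖inner ℂ (v l) z‖ ^ 2 := fun z l => by
    rw [norm_mul, mul_pow, Complex.norm_real, Real.norm_eq_abs, sq_abs]
  have hsum : ∀ z : Y, Summable fun l => ‖((r l : ℝ) : ℂ) * inner ℂ (v l) z‖ ^ 2 := fun z => by
    simp only [hnorm]
    exact Summable.of_nonneg_of_le (fun l => by positivity)
      (fun l => mul_le_of_le_one_left (by positivity) (pow_le_one₀ (hr0 l) (hr1 l)))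
      (hB.2 z (mem_univ z)).1
  have hexact : ∀ l, (r l * κ l) ^ 2 * ‖inner ℂ (u l) θ‖ ^ 2
      = ‖((r l : ℝ) : ℂ) * inner ℂ (v l) (K θ)‖ ^ 2 := fun l => by
    rw [hnorm, hK, norm_mul, mul_pow, mul_pow, Complex.norm_real, Real.norm_eq_abs, sq_abs,
      mul_assoc]
  have hdata : ∀ z : Y, ‖z‖ ≤ δ →
      √(∑' l, ‖((r l : ℝ) : ℂ) * inner ℂ (v l) z‖ ^ 2) ≤ √B * δ := by
    intro z hz
    obtain ⟨h1, h2⟩ := hB.2 z (mem_univ z)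
    have h3 : ∑' l, ‖((r l : ℝ) : ℂ) * inner ℂ (v l) z‖ ^ 2 ≤ B * ‖z‖ ^ 2 := by
      refine (Summable.tsum_le_tsum (fun l => ?_) (hsum z) h1).trans h2
      rw [hnorm]
      exact mul_le_of_le_one_left (by positivity) (pow_le_one₀ (hr0 l) (hr1 l))
    refine (Real.sqrt_le_sqrt h3).trans ?_
    rw [Real.sqrt_mul hB.1.le, Real.sqrt_sq (norm_nonneg _)]
    gcongr
  have hy' : ‖y - K θ‖ ≤ δ := by rwa [norm_sub_rev]
  have t1 := sqrt_tsum_sq_add_le u (hsum (y - K θ)) (hsum (K θ))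
  have t2 := sqrt_tsum_sq_add_le u (hsum (K θ - y)) (hsum y)
  simp only [← mul_add, ← inner_add_right, sub_add_cancel] at t1 t2
  simp only [hexact, ← hnorm]
  rw [abs_sub_le_iff]
  constructor
  · linarith [hdata _ hy']
  · linarith [hdata _ hy]

lemma summable_mul_kappa_sq (hK : ∀ l x, inner ℂ (v l) (K x) = (κ l : ℂ) * inner ℂ (u l) x)
    (hB : IsUpperFrameBound v univ B) {r : ι → ℝ} (hr0 : ∀ l, 0 ≤ r l) (hr1 : ∀ l, r l ≤ 1)
    (θ : X) : Summable fun l => (r l * κ l) ^ 2 * ‖inner ℂ (u l) θ‖ ^ 2 := by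
  refine Summable.of_nonneg_of_le (fun l => by positivity) (fun l => ?_)
    (hB.2 (K θ) (mem_univ _)).1
  rw [hK, norm_mul, mul_pow, mul_pow, Complex.norm_real, Real.norm_eq_abs, sq_abs, mul_assoc]
  exact mul_le_of_le_one_left (by positivity) (pow_le_one₀ (hr0 l) (hr1 l))

/-- Interpolation between the source condition and a residual of at most `τ √B δ`. -/
lemma sqrt_tsum_le_rate (hκ : ∀ l, 0 < κ l)
    (hK : ∀ l x, inner ℂ (v l) (K x) = (κ l : ℂ) * inner ℂ (u l) x)
    (hB : IsUpperFrameBound v univ B) (hp : 0 < p) (hE : 0 < E) (hδ : 0 < δ) (hτ : 0 < τ)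
    (hθ : θ ∈ sourceSet (fun μ => μ ^ (p / 2)) κ u E) (hy : ‖K θ - y‖ ≤ δ) {r : ι → ℝ}
    (hr0 : ∀ l, 0 ≤ r l) (hr1 : ∀ l, r l ≤ 1)
    (hres : √(∑' l, r l ^ 2 * ‖inner ℂ (v l) y‖ ^ 2) ≤ τ * √B * δ) :
    √(∑' l, r l ^ 2 * ‖inner ℂ (u l) θ‖ ^ 2)
      ≤ ((τ + 1) * √B) ^ (p / (p + 2)) * (δ ^ (p / (p + 2)) * E ^ (2 / (p + 2))) := by
  refine (sqrt_tsum_interpolation hκ hp hE hθ hr0 hr1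
    (summable_mul_kappa_sq hK hB hr0 hr1 θ)).trans ?_
  have h := (abs_sub_le_iff.1 (abs_sqrt_tsum_data_sub_le hK hB hy hr0 hr1)).2
  rw [← mul_assoc, ← Real.mul_rpow (by positivity) hδ.le]
  have hp2 : 0 ≤ p / (p + 2) := by positivity
  gcongr
  linarith

/-- A solution of the discrepancy equation is bounded below in terms of `δ / E`, because the
residual of exact data is at least `(τ - 1) √B δ`. -/
lemma le_sqrt_of_isMorozov (hκ : ∀ l, 0 < κ l)
    (hK : ∀ l x, inner ℂ (v l) (K x) = (κ l : ℂ) * inner ℂ (u l) x)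
    (hB : IsUpperFrameBound v univ B) (hp : 0 < p) (hp2 : p ≤ 2) (hE : 0 < E) (hδ : 0 < δ)
    (hτ : 1 < τ) (hθ : θ ∈ sourceSet (fun μ => μ ^ (p / 2)) κ u E) (hy : ‖K θ - y‖ ≤ δ)
    (hα : IsMorozov K κ u v τ B δ y α) :
    ((τ - 1) * √B) ^ (2 / (p + 2)) * (δ / E) ^ (2 / (p + 2)) ≤ √α := by
  obtain ⟨hα0, hd⟩ := hα
  have hB0 : 0 < √B := Real.sqrt_pos.2 hB.1
  have hτ1 : 0 < τ - 1 := by linarith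
  rw [discrepancy_eq hκ hα0 hK (hB.2 y (mem_univ y)).1] at hd
  have h := (abs_sub_le_iff.1 (abs_sqrt_tsum_data_sub_le hK hB hy
    (r := fun l => tikhonovResidual α (κ l)) (fun l => (tikhonovResidual_pos hα0 _).le)
    (fun l => tikhonovResidual_le_one hα0 _))).1
  rw [hd] at h
  have hb := tsum_sq_mul_le_of_mem_sourceSet hκ hθ
    (c := fun l => tikhonovResidual α (κ l) * κ l)
    (M := α ^ ((1 + p / 2) / 2))
    (fun l => mul_nonneg (tikhonovResidual_pos hα0 _).le (hκ l).le) (fun l => by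
      have := tikhonovResidual_mul_rpow_le hα0 (hκ l) (q := 1 + p / 2) (by linarith)
        (by linarith)
      rwa [Real.rpow_add (hκ l), Real.rpow_one, ← mul_assoc] at this)
  rw [← mul_pow] at hb
  have hb' := (Real.sqrt_le_sqrt hb).trans (Real.sqrt_sq (by positivity)).le
  have h1 : (τ - 1) * √B * (δ / E) ≤ α ^ ((1 + p / 2) / 2) := by
    rw [← mul_div_assoc, div_le_iff₀ hE]; linarith
  have h2 := Real.rpow_le_rpow (by positivity) h1 (by positivity : 0 ≤ 2 / (p + 2))
  rw [Real.mul_rpow (by positivity) (by positivity), ← Real.rpow_mul hα0.le] at h2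
  refine h2.trans_eq ?_
  rw [Real.sqrt_eq_rpow]
  congr 1
  field_simp
  ring

lemma norm_tikhonov_morozov_sub_le (hκ : ∀ l, 0 < κ l)
    (hK : ∀ l x, inner ℂ (v l) (K x) = (κ l : ℂ) * inner ℂ (u l) x)
    (hB : IsUpperFrameBound v univ B) (hp : 0 < p) (hp2 : p ≤ 2) (hE : 0 < E) (hδ : 0 < δ)
    (hτ : 1 < τ) (hθ : θ ∈ sourceSet (fun μ => μ ^ (p / 2)) κ u E) (hy : ‖K θ - y‖ ≤ δ)
    (hα : IsMorozov K κ u v τ B δ y α) :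
    ‖tikhonov κ u v α y - θ‖ ≤ (√B / 2 * (((τ - 1) * √B) ^ (2 / (p + 2)))⁻¹
      + ((τ + 1) * √B) ^ (p / (p + 2))) * δ ^ (p / (p + 2)) * E ^ (2 / (p + 2)) := by
  have hα0 := hα.1
  have hB0 : 0 < √B := Real.sqrt_pos.2 hB.1
  have hτ1 : 0 < τ - 1 := by linarith
  have hlow := le_sqrt_of_isMorozov hκ hK hB hp hp2 hE hδ hτ hθ hy hα
  have hd := hα.2
  rw [discrepancy_eq hκ hα0 hK (hB.2 y (mem_univ y)).1] at hd
  have hbias := sqrt_tsum_le_rate hκ hK hB hp hE hδ (by linarith : 0 < τ) hθ hy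
    (r := fun l => tikhonovResidual α (κ l)) (fun l => (tikhonovResidual_pos hα0 _).le)
    (fun l => tikhonovResidual_le_one hα0 _) hd.le
  have hdata : (2 * √α)⁻¹ * (√B * δ) ≤ √B / 2 * (((τ - 1) * √B) ^ (2 / (p + 2)))⁻¹
      * (δ ^ (p / (p + 2)) * E ^ (2 / (p + 2))) := by
    calc (2 * √α)⁻¹ * (√B * δ) = √B / 2 * δ * (√α)⁻¹ := by rw [mul_inv]; ring
      _ ≤ √B / 2 * δ * (((τ - 1) * √B) ^ (2 / (p + 2)) * (δ / E) ^ (2 / (p + 2)))⁻¹ := by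
          gcongr
      _ = _ := by rw [← noise_rate_eq hp hδ hE, mul_inv]; ring
  refine (norm_tikhonov_sub_le hκ hα0 hK hB hy).trans ((add_le_add hdata hbias).trans_eq ?_)
  ring

/-- If the discrepancy equation has no solution, the data are of the size of the noise: the
discrepancy is continuous in `α` with limits `0` and `(∑ |⟨y, v⟩|²)^{1/2}` at `0` and `∞`. -/
lemma sqrt_tsum_le_of_not_exists_isMorozov (hκ : ∀ l, 0 < κ l)
    (hK : ∀ l x, inner ℂ (v l) (K x) = (κ l : ℂ) * inner ℂ (u l) x)
    (hy : Summable fun l => ‖inner ℂ (v l) y‖ ^ 2) (hD : 0 < τ * √B * δ)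
    (hno : ¬ ∃ α, IsMorozov K κ u v τ B δ y α) :
    √(∑' l, ‖inner ℂ (v l) y‖ ^ 2) ≤ τ * √B * δ := by
  by_contra! hlt
  set d : ℝ → ℝ := fun α => √(∑' l, tikhonovResidual α (κ l) ^ 2 * ‖inner ℂ (v l) y‖ ^ 2) with hd
  have hbound : ∀ α ∈ Ioi (0 : ℝ), ∀ l,
      ‖tikhonovResidual α (κ l) ^ 2 * ‖inner ℂ (v l) y‖ ^ 2‖ ≤ ‖inner ℂ (v l) y‖ ^ 2 := by
    intro α hα l
    rw [Real.norm_of_nonneg (by positivity)]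
    exact mul_le_of_le_one_left (by positivity)
      (pow_le_one₀ (tikhonovResidual_pos hα _).le (tikhonovResidual_le_one hα _))
  have hcont : ContinuousOn d (Ioi 0) := by
    refine (continuousOn_tsum (fun l => ?_) hy fun l α hα => hbound α hα l).sqrt
    refine ContinuousOn.mul (ContinuousOn.pow ?_ 2) continuousOn_const
    unfold tikhonovResidual
    refine ContinuousOn.div continuousOn_id (by fun_prop) fun α hα => ?_
    have h1 : (0 : ℝ) < α := hα
    positivity
  have hzero : Tendsto d (𝓝[>] 0) (𝓝 0) := by
    have : Tendsto (fun α => ∑' l, tikhonovResidual α (κ l) ^ 2 * ‖inner ℂ (v l) y‖ ^ 2)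
        (𝓝[>] 0) (𝓝 (∑' l : ι, (0 : ℝ))) := by
      refine tendsto_tsum_of_dominated_convergence hy (fun l => ?_)
        (by filter_upwards [self_mem_nhdsWithin] with α hα using hbound α hα)
      have hk := hκ l
      have hc : ContinuousAt (fun α : ℝ => tikhonovResidual α (κ l) ^ 2
          * ‖inner ℂ (v l) y‖ ^ 2) 0 := by
        unfold tikhonovResidual
        refine ContinuousAt.mul (ContinuousAt.pow (ContinuousAt.div continuousAt_id
          (by fun_prop) ?_) 2) continuousAt_const
        positivity
      have h := hc.tendsto
      simp only [tikhonovResidual, zero_div, ne_eq, OfNat.ofNat_ne_zero, not_false_eq_true,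
        zero_pow, zero_mul] at h
      exact h.mono_left nhdsWithin_le_nhds
    simpa [hd] using this.sqrt
  have hinf : Tendsto d atTop (𝓝 √(∑' l, ‖inner ℂ (v l) y‖ ^ 2)) := by
    refine Tendsto.sqrt ?_
    refine tendsto_tsum_of_dominated_convergence hy (fun l => ?_)
      (by filter_upwards [Ioi_mem_atTop (0 : ℝ)] with α hα using hbound α hα)
    have h1 : Tendsto (fun α : ℝ => tikhonovResidual α (κ l)) atTop (𝓝 1) := by
      have h2 : Tendsto (fun α : ℝ => 1 - κ l ^ 2 / (α + κ l ^ 2)) atTop (𝓝 (1 - 0)) :=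
        tendsto_const_nhds.sub (tendsto_const_nhds.div_atTop
          (tendsto_atTop_add_const_right _ _ tendsto_id))
      rw [sub_zero] at h2
      refine h2.congr' ?_
      filter_upwards [Ioi_mem_atTop (0 : ℝ)] with α hα
      have h3 : (0 : ℝ) < α := hα
      have h4 : α + κ l ^ 2 ≠ 0 := by positivity
      unfold tikhonovResidual
      field_simp
      ring
    simpa using (h1.pow 2).mul_const (‖inner ℂ (v l) y‖ ^ 2)
  obtain ⟨α₁, hα₁, hd₁⟩ := ((hzero.eventually_lt_const hD).and self_mem_nhdsWithin).exists.imp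
    fun α h => And.intro h.2 h.1
  obtain ⟨α₂, hα₂, hd₂⟩ := ((hinf.eventually_const_lt hlt).and (Ioi_mem_atTop 0)).exists.imp
    fun α h => And.intro h.2 h.1
  obtain ⟨α, hα, hαd⟩ := isPreconnected_Ioi.intermediate_value hα₁ hα₂ hcont
    ⟨hd₁.le, hd₂.le⟩
  exact hno ⟨α, hα, by rw [discrepancy_eq hκ hα hK hy]; exact hαd⟩

lemma norm_morozovMethod_sub_le (hκ : ∀ l, 0 < κ l)
    (hK : ∀ l x, inner ℂ (v l) (K x) = (κ l : ℂ) * inner ℂ (u l) x)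
    (hB : IsUpperFrameBound v univ B) (hp : 0 < p) (hp2 : p ≤ 2) (hE : 0 < E) (hδ : 0 < δ)
    (hτ : 1 < τ) (hθ : θ ∈ sourceSet (fun μ => μ ^ (p / 2)) κ u E) (hy : ‖K θ - y‖ ≤ δ)
    {αD : ℝ → Y → ℝ} (hαD : IsMorozovRule K κ u v τ B αD) :
    ‖morozovMethod K κ u v τ B αD δ y - θ‖ ≤ (√B / 2 * (((τ - 1) * √B) ^ (2 / (p + 2)))⁻¹
      + ((τ + 1) * √B) ^ (p / (p + 2))) * δ ^ (p / (p + 2)) * E ^ (2 / (p + 2)) := by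
  have hB0 : 0 < √B := Real.sqrt_pos.2 hB.1
  have hτ1 : 0 < τ - 1 := by linarith
  unfold morozovMethod
  split_ifs with h
  · exact norm_tikhonov_morozov_sub_le hκ hK hB hp hp2 hE hδ hτ hθ hy (hαD δ hδ y h)
  · have hres := sqrt_tsum_le_of_not_exists_isMorozov hκ hK (hB.2 y (mem_univ y)).1
      (by positivity) h
    have hrate := sqrt_tsum_le_rate hκ hK hB hp hE hδ (by linarith : 0 < τ) hθ hy
      (r := fun _ => 1) (fun _ => zero_le_one) (fun _ => le_rfl) (by simpa using hres)
    simp only [one_pow, one_mul, (u.hasSum_norm_inner_sq θ).tsum_eq,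
      Real.sqrt_sq (norm_nonneg _)] at hrate
    rw [zero_sub, norm_neg]
    refine hrate.trans ?_
    rw [← mul_assoc]
    gcongr
    exact le_add_of_nonneg_left (by positivity)

end Abstract

/-! ### Order optimality -/

section Optimality

variable {ι X Y : Type*} [NormedAddCommGroup X] [InnerProductSpace ℂ X] [NormedAddCommGroup Y]
  {κ : ι → ℝ} {u : HilbertBasis ι ℂ X} {p E δ : ℝ} {K : X → Y}

/-- No method can distinguish `x` from `-x` when both are compatible with the data `0`. -/
lemma ofReal_norm_le_iInf_worstCaseError {M : Set X} {x : X} (hx : x ∈ M) (hx' : -x ∈ M)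
    (hKx : ‖K x‖ ≤ δ) (hKx' : ‖K (-x)‖ ≤ δ) :
    ENNReal.ofReal ‖x‖ ≤ ⨅ R : Y → X, worstCaseError K M δ R := by
  refine le_iInf fun R => ?_
  have hle : ∀ z ∈ M, ‖K z‖ ≤ δ → ENNReal.ofReal ‖R 0 - z‖ ≤ worstCaseError K M δ R := by
    intro z hz hKz
    unfold worstCaseError
    exact le_iSup₂_of_le z hz (le_iSup₂_of_le 0 (by rwa [sub_zero]) le_rfl)
  have htri : 2 * ‖x‖ ≤ ‖R 0 - x‖ + ‖R 0 - -x‖ := by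
    have h := norm_sub_le (R 0 - -x) (R 0 - x)
    have e : R 0 - -x - (R 0 - x) = (2 : ℝ) • x := by rw [two_smul]; abel
    rw [e, norm_smul, Real.norm_ofNat] at h
    linarith
  rcases le_total ‖x‖ ‖R 0 - x‖ with h | h
  · exact (ENNReal.ofReal_le_ofReal h).trans (hle x hx hKx)
  · exact (ENNReal.ofReal_le_ofReal (by linarith)).trans (hle (-x) hx' hKx')

lemma smul_mem_sourceSet (hκ : ∀ l, 0 < κ l) {l : ι} {c : ℝ} (hc : |c| = E * κ l ^ (p / 2)) :
    (c : ℂ) • u l ∈ sourceSet (fun μ => μ ^ (p / 2)) κ u E := by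
  classical
  rw [mem_sourceSet_rpow_iff hκ]
  have hcoef : ∀ k, k ≠ l → (κ k ^ p)⁻¹ * ‖inner ℂ (u k) ((c : ℂ) • u l)‖ ^ 2 = 0 := by
    intro k hk
    rw [inner_smul_right, u.orthonormal.inner_eq_zero hk]
    simp
  refine ⟨summable_of_ne_finset_zero (s := {l}) fun k hk => hcoef k (by simpa using hk), ?_⟩
  rw [tsum_eq_single l hcoef, inner_smul_right, inner_self_eq_norm_sq_to_K,
    u.orthonormal.norm_eq_one]
  have hk := hκ l
  have hkp := Real.rpow_pos_of_pos hk p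
  have h2 : (κ l ^ (p / 2)) ^ 2 = κ l ^ p := by
    rw [← Real.rpow_natCast, ← Real.rpow_mul hk.le]; congr 1; push_cast; ring
  simp only [RCLike.ofReal_one, one_pow, mul_one, Complex.norm_real, Real.norm_eq_abs]
  rw [hc, mul_pow, h2, mul_left_comm, inv_mul_cancel₀ hkp.ne', mul_one]

/-- A method with the rate `δ ^ (p / (p + 2)) * E ^ (2 / (p + 2))` is order optimal as soon as the
operator is smoothing at the rate `κ` along basis vectors whose `κ` fill `(0, 1]` up to a
factor: the elements `E κ ^ (p / 2) u` of the source set are then lost in the noise. -/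
lemma uniformOrderOptimal_of_rate (hκ : ∀ l, 0 < κ l) (hp : 0 < p) (hE : 0 < E) {C C' : ℝ}
    (hC : 0 < C) (hC' : 0 < C')
    (hKu : ∀ t : ℝ, 0 < t → t < 1 → ∃ l, t / 4 ≤ κ l ∧ κ l ≤ t ∧
      ∀ c : ℝ, ‖K ((c : ℂ) • u l)‖ ≤ C * κ l * |c|)
    {R : ℝ → Y → X}
    (hR : ∀ δ : ℝ, 0 < δ → ∀ θ ∈ sourceSet (fun μ => μ ^ (p / 2)) κ u E, ∀ y : Y,
      ‖K θ - y‖ ≤ δ → ‖R δ y - θ‖ ≤ C' * δ ^ (p / (p + 2)) * E ^ (2 / (p + 2))) :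
    UniformOrderOptimal K (sourceSet (fun μ => μ ^ (p / 2)) κ u E) R := by
  set c₀ : ℝ := ((4 : ℝ) ^ (p / 2))⁻¹ * (C ^ (p / (p + 2)))⁻¹ with hc₀
  have hc₀pos : 0 < c₀ := by positivity
  refine ⟨C' / c₀, by positivity, C * E, by positivity, fun δ hδ hδ₀ => ?_⟩
  have hupper : worstCaseError K (sourceSet (fun μ => μ ^ (p / 2)) κ u E) δ (R δ)
      ≤ ENNReal.ofReal (C' * δ ^ (p / (p + 2)) * E ^ (2 / (p + 2))) :=
    iSup₂_le fun θ hθ => iSup₂_le fun y hy => ENNReal.ofReal_le_ofReal (hR δ hδ θ hθ y hy)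
  -- `t` is chosen such that `C E t ^ ((p + 2) / 2) = δ`
  set t : ℝ := (δ / (C * E)) ^ (2 / (p + 2)) with ht
  have hq0 : 0 < δ / (C * E) := by positivity
  have hq1 : δ / (C * E) < 1 := (div_lt_one (by positivity)).2 hδ₀
  have ht0 : 0 < t := by positivity
  obtain ⟨l, hl1, hl2, hKl⟩ := hKu t ht0 (Real.rpow_lt_one hq0.le hq1 (by positivity))
  have hk := hκ l
  have hkp : 0 < κ l ^ (p / 2) := by positivity
  set e : ℝ := E * κ l ^ (p / 2) with he
  have he0 : 0 < e := by positivity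
  have hKe : ∀ c : ℝ, |c| = e → ‖K ((c : ℂ) • u l)‖ ≤ δ := by
    intro c hc
    calc ‖K ((c : ℂ) • u l)‖ ≤ C * κ l * |c| := hKl c
      _ = C * E * κ l ^ ((p + 2) / 2) := by
          rw [hc, he, show (p + 2) / 2 = p / 2 + 1 by ring, Real.rpow_add_one hk.ne']; ring
      _ ≤ C * E * t ^ ((p + 2) / 2) := by gcongr
      _ = δ := by
          rw [ht, ← Real.rpow_mul hq0.le, show 2 / (p + 2) * ((p + 2) / 2) = 1 by field_simp,
            Real.rpow_one]
          field_simp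
  have habs : |(-e)| = e := by rw [abs_neg, abs_of_pos he0]
  have hneg : -((e : ℂ) • u l) = ((-e : ℝ) : ℂ) • u l := by push_cast; rw [neg_smul]
  have hlower := ofReal_norm_le_iInf_worstCaseError (K := K) (δ := δ)
    (smul_mem_sourceSet (u := u) hκ (abs_of_pos he0))
    (by rw [hneg]; exact smul_mem_sourceSet hκ habs) (hKe e (abs_of_pos he0))
    (by rw [hneg]; exact hKe (-e) habs)
  have hnorm : ‖(e : ℂ) • u l‖ = e := by
    rw [norm_smul, u.orthonormal.norm_eq_one, mul_one, Complex.norm_real,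
      Real.norm_of_nonneg he0.le]
  have hrate : c₀ * (δ ^ (p / (p + 2)) * E ^ (2 / (p + 2))) ≤ e := by
    calc c₀ * (δ ^ (p / (p + 2)) * E ^ (2 / (p + 2)))
        = E * (t / 4) ^ (p / 2) := by
          rw [Real.div_rpow ht0.le (by norm_num), ht, ← Real.rpow_mul hq0.le,
            show 2 / (p + 2) * (p / 2) = p / (p + 2) by field_simp,
            ← bias_rate_eq hp hδ hE, mul_comm C E, ← div_div,
            Real.div_rpow (by positivity) hC.le, hc₀]
          ring
      _ ≤ e := by rw [he]; gcongr
  calc worstCaseError K (sourceSet (fun μ => μ ^ (p / 2)) κ u E) δ (R δ)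
      ≤ ENNReal.ofReal (C' * δ ^ (p / (p + 2)) * E ^ (2 / (p + 2))) := hupper
    _ ≤ ENNReal.ofReal (C' / c₀ * e) := by
        refine ENNReal.ofReal_le_ofReal ?_
        calc C' * δ ^ (p / (p + 2)) * E ^ (2 / (p + 2))
            = C' / c₀ * (c₀ * (δ ^ (p / (p + 2)) * E ^ (2 / (p + 2)))) := by field_simp
          _ ≤ _ := by gcongr
    _ = ENNReal.ofReal (C' / c₀) * ENNReal.ofReal e := ENNReal.ofReal_mul (by positivity)
    _ ≤ _ := by rw [hnorm] at hlower; gcongr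

end Optimality

/-! ### The fractional backward problem -/

lemma exists_kappa_mem_Icc {t : ℝ} (ht0 : 0 < t) (ht1 : t < 1) :
    ∃ l : ℤ × ℤ, 1 ≤ l.1 ∧ t / 4 ≤ kappa l ∧ kappa l ≤ t := by
  obtain ⟨n, h1, h2⟩ := exists_nat_pow_near_of_lt_one ht0 ht1.le
    (by norm_num : (0 : ℝ) < 1 / 4) (by norm_num)
  have hk : kappa ((n + 1 : ℕ), 0) = (1 / 4 : ℝ) ^ (n + 1) := by
    rw [kappa_of_one_le (by simp), zpow_natCast, ← pow_mul, mul_comm, pow_mul, one_div, inv_pow]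
    norm_num
  refine ⟨((n + 1 : ℕ), 0), by simp, ?_, ?_⟩
  · rw [hk, pow_succ]; linarith
  · rw [hk]; exact h1.le

theorem mainTheorem8 (γ T : ℝ) (hγ0 : 0 < γ) (hγ1 : γ < 1) (hT : 0 < T)
    (ψ : L2) (u : HilbertBasis (ℤ × ℤ) ℂ L2) (hu : IsWaveletBasis ψ u)
    (a b : ℝ) (ha : 0 < a) (hb : 0 < b) (hψ : FourierSupportedIn ψ a b)
    (p : ℝ) (hp : 0 < p) :
    -- the series that defines the regularized solution converges
    (∀ α : ℝ, 0 < α → ∀ y : L2,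
      Summable (filterTerm (tikhonovFilter α) kappa u (vaguelette γ T u) y)) ∧
    -- (a) a priori parameter choice
    (p ≤ 4 →
      (∃ C : ℝ, 0 < C ∧ ∀ E : ℝ, 0 < E → ∀ δ : ℝ, 0 < δ →
        ∀ θ₀ ∈ waveletSourceSet u p E, ∀ y : L2, ‖forwardOp γ T θ₀ - y‖ ≤ δ →
          ‖regSolution γ T u ((δ / E) ^ (4 / (p + 2))) y - θ₀‖
            ≤ C * δ ^ (p / (p + 2)) * E ^ (2 / (p + 2))) ∧
      (∀ E : ℝ, 0 < E →
        UniformOrderOptimal (forwardOp γ T) (waveletSourceSet u p E)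
          (fun δ y => regSolution γ T u ((δ / E) ^ (4 / (p + 2))) y))) ∧
    -- (b) a posteriori parameter choice by the Morozov principle
    (p ≤ 2 → ∀ τ : ℝ, 1 < τ → ∀ B : ℝ,
      IsUpperFrameBound (vaguelette γ T u) (closure (Set.range (forwardOp γ T))) B →
      (∃ C : ℝ, 0 < C ∧ ∀ E : ℝ, 0 < E → ∀ δ : ℝ, 0 < δ →
        ∀ θ₀ ∈ waveletSourceSet u p E, ∀ y : L2, ‖forwardOp γ T θ₀ - y‖ ≤ δ →
          ∀ α : ℝ, IsMorozov (forwardOp γ T) kappa u (vaguelette γ T u) τ B δ y α →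
            ‖regSolution γ T u α y - θ₀‖ ≤ C * δ ^ (p / (p + 2)) * E ^ (2 / (p + 2))) ∧
      (∀ E : ℝ, 0 < E → ∀ αD : ℝ → L2 → ℝ,
        IsMorozovRule (forwardOp γ T) kappa u (vaguelette γ T u) τ B αD →
        UniformOrderOptimal (forwardOp γ T) (waveletSourceSet u p E)
          (morozovMethod (forwardOp γ T) kappa u (vaguelette γ T u) τ B αD))) := by
  have hK := inner_vaguelette_forwardOp hγ0 hγ1 hT hu hψ
  obtain ⟨B₀, hB₀⟩ := exists_isUpperFrameBound_vaguelette hγ0 hγ1 hT hu ha hψ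
  obtain ⟨C, hC, hCu⟩ := exists_norm_forwardOp_wavelet_le hγ0 hγ1 hT hu ha hψ
  have hKu : ∀ t : ℝ, 0 < t → t < 1 → ∃ l, t / 4 ≤ kappa l ∧ kappa l ≤ t ∧
      ∀ c : ℝ, ‖forwardOp γ T ((c : ℂ) • u l)‖ ≤ C * kappa l * |c| := by
    intro t ht0 ht1
    obtain ⟨l, hl, h1, h2⟩ := exists_kappa_mem_Icc ht0 ht1
    refine ⟨l, h1, h2, fun c => ?_⟩
    rw [(isLinearMap_forwardOp hγ0 hγ1 hT).map_smul, norm_smul, Complex.norm_real,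
      Real.norm_eq_abs, mul_comm]
    exact mul_le_mul_of_nonneg_right (hCu l hl) (abs_nonneg c)
  refine ⟨fun α hα y =>
      (summable_filterTerm_and_inner_tikhonov kappa_pos hα (hB₀.2 y (mem_univ y)).1).1,
    fun hp4 => ⟨⟨√B₀ / 2 + 1, by positivity, fun E hE δ hδ θ hθ y hy =>
      norm_tikhonov_apriori_sub_le kappa_pos hK hB₀ hp hp4 hE hδ hθ hy⟩, fun E hE =>
      uniformOrderOptimal_of_rate kappa_pos hp hE hC (by positivity : 0 < √B₀ / 2 + 1) hKu
        fun δ hδ θ hθ y hy =>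
          norm_tikhonov_apriori_sub_le kappa_pos hK hB₀ hp hp4 hE hδ hθ hy⟩,
    fun hp2 τ hτ B hB => ?_⟩
  rw [closure_range_forwardOp hγ0 hγ1 hT] at hB
  have hB0 : 0 < √B := Real.sqrt_pos.2 hB.1
  have hτ1 : 0 < τ - 1 := by linarith
  have hC' : 0 < √B / 2 * (((τ - 1) * √B) ^ (2 / (p + 2)))⁻¹ + ((τ + 1) * √B) ^ (p / (p + 2)) := by
    positivity
  exact ⟨⟨_, hC', fun E hE δ hδ θ hθ y hy α hα =>
      norm_tikhonov_morozov_sub_le kappa_pos hK hB hp hp2 hE hδ hτ hθ hy hα⟩,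
    fun E hE αD hαD => uniformOrderOptimal_of_rate kappa_pos hp hE hC hC' hKu
      fun δ hδ θ hθ y hy => norm_morozovMethod_sub_le kappa_pos hK hB hp hp2 hE hδ hτ hθ hy hαD⟩
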